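/- All graphs are finite and simple, and membership in a family of graphs is up to isomorphism. Let $P_n$ denote the path of order $n$. A graph $G$ is *hypomatchable* if $G-x$ has a perfect matching for every $x\in V(G)$. A *$\{P_2,P_9\}$-factor* of $G$ is a spanning subgraph of $G$ each of whose components is isomorphic to $P_2$ or $P_9$. For nonnegative integers $s_1,s_2,s_3$, let $Q=u_1u_2u_3$ be a path of order $3$ and, for $i\in\{1,2,3\}$ and $1\le j\le s_i$, let $L_{i,j}$ be a path of order $2$, all these paths being pairwise disjoint; write $L_{2,j}=v_{1,j}v_{3,j}$. Let $B=Q\cup\bigcup_{i,j}L_{i,j}$. Define the following graphs. * $A_1(s_1,s_2,s_3)$ is obtained from $B$ by adding the edge $u_1u_3$ and joining $u_i$ to all vertices in $\bigcup_{1\le j\le s_i}V(L_{i,j})$ for each $i\in\{1,2,3\}$. * $A_2'(s_1,s_2,s_3)$ is obtained from $B$ by joining $u_i$ to all vertices in $\bigcup_{1\le j\le s_i}V(L_{i,j})\cup\{v_{i,j}\mid 1\le j\le s_2\}$ for each $i\in\{1,3\}$. * $A_2''(s_1,s_2,s_3)$ is obtained from $B$ by adding the edge $u_1u_3$ and joining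 $u_i$ to all vertices in $\bigcup_{1\le j\le s_i}V(L_{i,j})\cup\bigcup_{1\le j\le s_2}V(L_{2,j})$ for each $i\in\{1,3\}$. * $A_3'(s_1)=A_2'(s_1,1,0)$, and $A_3''(s_1)$ is obtained from $A_3'(s_1)$ by joining all pairs of distinct vertices in $V(Q)\cup V(L_{2,1})$. * $A_4'(s_1)$ is obtained from $A_2'(s_1,2,0)$ by adding the edge $v_{3,1}v_{3,2}$, and $A_4''(s_1)$ is obtained from $A_4'(s_1)$ by adding the edges $u_1u_3$, $u_1v_{3,1}$, $u_1v_{3,2}$. Define the families $$\mathcal G_1=\{A_1(s_1,s_2,s_3)\mid s_1+s_2+s_3\ge 3\},$$ $$\mathcal G_2=\{H\mid A_2'(s_1,s_2,s_3)\subseteq H\subseteq A_2''(s_1,s_2,s_3),\ s_2\ge 1,\ s_1+s_2+s_3\ge 3,\ \text{and either } (s_1\ge 1 \text{ and } s_3\ge 1) \text{ or } s_2\ge 2\},$$ $$\mathcal G_3=\{H\mid A_3'(s_1)\subseteq H\subseteq A_3''(s_1),\ s_1\ge 2\},\qquad \mathcal G_4=\{H\mid A_4'(s_1)\subseteq H\subseteq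 A_4''(s_1),\ s_1\ge 1\}.$$ **Proposition.** Let $G$ be a hypomatchable graph of order at least $9$ having no $\{P_2,P_9\}$-factor. Then $G\in\mathcal G_1\cup\mathcal G_2\cup\mathcal G_3\cup\mathcal G_4$. -/

import Mathlib

/-- A graph `G` is hypomatchable if `G - x` has a perfect matching for every vertex `x`. -/
def Hypomatchable {V : Type*} (G : SimpleGraph V) : Prop :=
  ∀ x : V, ∃ M : (G.induce ({x}ᶜ : Set V)).Subgraph, M.IsPerfectMatching

/-- `G` has a `{P_n | n ∈ S}`-factor: a spanning subgraph `F` of `G` each of whose components is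
isomorphic to the path of order `n` for some `n ∈ S`. -/
def HasPathFactor {V : Type*} (S : Set ℕ) (G : SimpleGraph V) : Prop :=
  ∃ F : SimpleGraph V, F ≤ G ∧
    ∀ C : F.ConnectedComponent, ∃ n ∈ S, Nonempty (C.toSimpleGraph ≃g SimpleGraph.pathGraph n)

namespace HypoFamilies

/-- The vertices of `Q ∪ ⋃ L_{i,j}`: the vertices `u₁, u₂, u₃` of the path `Q`, the two vertices
`x₁ j false`, `x₁ j true` of `L_{1,j}` for `j < s₁`, the two vertices `v₁ j`, `v₃ j` of `L_{2,j}` for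
`j < s₂`, and the two vertices `x₃ j false`, `x₃ j true` of `L_{3,j}` for `j < s₃`. -/
inductive Vertex (s₁ s₂ s₃ : ℕ) : Type
  | u₁ : Vertex s₁ s₂ s₃
  | u₂ : Vertex s₁ s₂ s₃
  | u₃ : Vertex s₁ s₂ s₃
  | x₁ (j : Fin s₁) (e : Bool) : Vertex s₁ s₂ s₃
  | v₁ (j : Fin s₂) : Vertex s₁ s₂ s₃
  | v₃ (j : Fin s₂) : Vertex s₁ s₂ s₃
  | x₃ (j : Fin s₃) (e : Bool) : Vertex s₁ s₂ s₃

open Vertex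

/-- The union of the vertex sets of the paths `L_{1,j}`. -/
def L₁ (s₁ s₂ s₃ : ℕ) : Set (Vertex s₁ s₂ s₃) := {w | ∃ j e, w = x₁ j e}

/-- The union of the vertex sets of the paths `L_{2,j}`. -/
def L₂ (s₁ s₂ s₃ : ℕ) : Set (Vertex s₁ s₂ s₃) := {w | ∃ j, w = v₁ j ∨ w = v₃ j}

/-- The union of the vertex sets of the paths `L_{3,j}`. -/
def L₃ (s₁ s₂ s₃ : ℕ) : Set (Vertex s₁ s₂ s₃) := {w | ∃ j e, w = x₃ j e}

/-- The edges of `Q ∪ ⋃ L_{i,j}`, each listed in one direction. -/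
inductive BaseEdge (s₁ s₂ s₃ : ℕ) : Vertex s₁ s₂ s₃ → Vertex s₁ s₂ s₃ → Prop
  | q₁₂ : BaseEdge s₁ s₂ s₃ u₁ u₂
  | q₂₃ : BaseEdge s₁ s₂ s₃ u₂ u₃
  | l₁ (j : Fin s₁) : BaseEdge s₁ s₂ s₃ (x₁ j false) (x₁ j true)
  | l₂ (j : Fin s₂) : BaseEdge s₁ s₂ s₃ (v₁ j) (v₃ j)
  | l₃ (j : Fin s₃) : BaseEdge s₁ s₂ s₃ (x₃ j false) (x₃ j true)

/-- The disjoint union of the path `Q = u₁u₂u₃` and the `s₁ + s₂ + s₃` paths `L_{i,j}`. -/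
def base (s₁ s₂ s₃ : ℕ) : SimpleGraph (Vertex s₁ s₂ s₃) :=
  SimpleGraph.fromRel (BaseEdge s₁ s₂ s₃)

/-- The graph whose edges join the vertex `u` to all vertices of `S` (other than `u`). -/
def joinTo {V : Type*} (u : V) (S : Set V) : SimpleGraph V :=
  SimpleGraph.fromRel fun a b => a = u ∧ b ∈ S

/-- The graph whose edges join all pairs of distinct vertices of `S`. -/
def completeOn {V : Type*} (S : Set V) : SimpleGraph V :=
  SimpleGraph.fromRel fun a b => a ∈ S ∧ b ∈ S

/-- The graph `A₁(s₁, s₂, s₃)`. -/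
def A₁ (s₁ s₂ s₃ : ℕ) : SimpleGraph (Vertex s₁ s₂ s₃) :=
  base s₁ s₂ s₃ ⊔ SimpleGraph.edge u₁ u₃
    ⊔ joinTo u₁ (L₁ s₁ s₂ s₃) ⊔ joinTo u₂ (L₂ s₁ s₂ s₃) ⊔ joinTo u₃ (L₃ s₁ s₂ s₃)

/-- The graph `A₂'(s₁, s₂, s₃)`. -/
def A₂min (s₁ s₂ s₃ : ℕ) : SimpleGraph (Vertex s₁ s₂ s₃) :=
  base s₁ s₂ s₃
    ⊔ joinTo u₁ (L₁ s₁ s₂ s₃ ∪ Set.range v₁) ⊔ joinTo u₃ (L₃ s₁ s₂ s₃ ∪ Set.range v₃)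

/-- The graph `A₂''(s₁, s₂, s₃)`. -/
def A₂max (s₁ s₂ s₃ : ℕ) : SimpleGraph (Vertex s₁ s₂ s₃) :=
  base s₁ s₂ s₃ ⊔ SimpleGraph.edge u₁ u₃
    ⊔ joinTo u₁ (L₁ s₁ s₂ s₃ ∪ L₂ s₁ s₂ s₃) ⊔ joinTo u₃ (L₃ s₁ s₂ s₃ ∪ L₂ s₁ s₂ s₃)

/-- The graph `A₃'(s₁)`. -/
def A₃min (s₁ : ℕ) : SimpleGraph (Vertex s₁ 1 0) := A₂min s₁ 1 0

/-- The graph `A₃''(s₁)`. -/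
def A₃max (s₁ : ℕ) : SimpleGraph (Vertex s₁ 1 0) :=
  A₃min s₁ ⊔ completeOn ({u₁, u₂, u₃} ∪ L₂ s₁ 1 0)

/-- The graph `A₄'(s₁)`. -/
def A₄min (s₁ : ℕ) : SimpleGraph (Vertex s₁ 2 0) :=
  A₂min s₁ 2 0 ⊔ SimpleGraph.edge (v₃ 0) (v₃ 1)

/-- The graph `A₄''(s₁)`. -/
def A₄max (s₁ : ℕ) : SimpleGraph (Vertex s₁ 2 0) :=
  A₄min s₁ ⊔ SimpleGraph.edge u₁ u₃ ⊔ SimpleGraph.edge u₁ (v₃ 0) ⊔ SimpleGraph.edge u₁ (v₃ 1)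

variable {V : Type*}

/-- `G` belongs, up to isomorphism, to the family `𝒢₁`. -/
def Mem𝒢₁ (G : SimpleGraph V) : Prop :=
  ∃ s₁ s₂ s₃ : ℕ, 3 ≤ s₁ + s₂ + s₃ ∧ Nonempty (G ≃g A₁ s₁ s₂ s₃)

/-- `G` belongs, up to isomorphism, to the family `𝒢₂`. -/
def Mem𝒢₂ (G : SimpleGraph V) : Prop :=
  ∃ s₁ s₂ s₃ : ℕ, 1 ≤ s₂ ∧ 3 ≤ s₁ + s₂ + s₃ ∧ ((1 ≤ s₁ ∧ 1 ≤ s₃) ∨ 2 ≤ s₂) ∧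
    ∃ H : SimpleGraph (Vertex s₁ s₂ s₃),
      A₂min s₁ s₂ s₃ ≤ H ∧ H ≤ A₂max s₁ s₂ s₃ ∧ Nonempty (G ≃g H)

/-- `G` belongs, up to isomorphism, to the family `𝒢₃`. -/
def Mem𝒢₃ (G : SimpleGraph V) : Prop :=
  ∃ s₁ : ℕ, 2 ≤ s₁ ∧
    ∃ H : SimpleGraph (Vertex s₁ 1 0), A₃min s₁ ≤ H ∧ H ≤ A₃max s₁ ∧ Nonempty (G ≃g H)

/-- `G` belongs, up to isomorphism, to the family `𝒢₄`. -/
def Mem𝒢₄ (G : SimpleGraph V) : Prop :=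
  ∃ s₁ : ℕ, 1 ≤ s₁ ∧
    ∃ H : SimpleGraph (Vertex s₁ 2 0), A₄min s₁ ≤ H ∧ H ≤ A₄max s₁ ∧ Nonempty (G ≃g H)

end HypoFamilies

/-! A path of order 9 whose complement is perfectly matched, together with that matching, is a
forbidden factor; hence `NoNicePath`. The whole argument plays this against hypomatchability.

Let `f` be a matching missing only `x`, and let `xa` be an edge. Superposing `f` with a matching
missing only `a` yields an alternating path from `x` to `a`, which `xa` closes to an odd cycle whose
complement is still matched by `f`. If the cycle has at least 9 vertices, the first nine vertices of
the path form a forbidden path. A 7-cycle extends to a forbidden path through a matched pair hanging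
on it. So the cycle has length 3 or 5 (`blossom`). From here on, cycles and paths are "nice" when
their complement is matched.

Suppose there is no nice pentagon. On a nice triangle, `blossom` makes a corner adjacent to both or
neither vertex of each matched pair, and a pair seen by two corners would create a nice pentagon.
Some nice triangle is adjacent to every outside vertex (`NoNicePentagon.exists_isFull`), and then
the only edges between outside vertices are matching edges. This is the first family.

Suppose there is a nice pentagon. Every outside vertex is adjacent to it, and the only edges between
outside vertices are matching edges. Attachments at consecutive pentagon vertices produce a
forbidden path or a nice 7-cycle, unless one vertex `c` carries both; then its mate is attached
exactly at the opposite pentagon vertex, which leads to 𝒢₄. Otherwise the attachment vertices are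
pairwise nonconsecutive on the pentagon: one of them gives 𝒢₃, two give 𝒢₂. The remaining chord
restrictions come from nice 7-cycles and nice paths. -/

open SimpleGraph

/-! ### Matchings as involutions, and the factor produced by a nice path. -/

section Matching

variable {V : Type*} {G : SimpleGraph V}

/-- The map `f` pairs up the vertices of `S` along edges of `G`. -/
def IsMatch (G : SimpleGraph V) (f : V → V) (S : Set V) : Prop :=
  ∀ v ∈ S, f v ∈ S ∧ G.Adj v (f v) ∧ f (f v) = v

/-- No path of order `9` in `G` has a complement with a perfect matching. -/
def NoNicePath (G : SimpleGraph V) : Prop :=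
  ∀ l : List V, l.length = 9 → l.Nodup → l.IsChain G.Adj → ∀ f, ¬ IsMatch G f {v | v ∉ l}

theorem IsMatch.subset {f : V → V} {S T : Set V} (h : IsMatch G f S) (hT : T ⊆ S)
    (hf : ∀ v ∈ T, f v ∈ T) : IsMatch G f T :=
  fun v hv => ⟨hf v hv, (h v (hT hv)).2⟩

theorem Hypomatchable.exists_isMatch (hG : Hypomatchable G) (x : V) :
    ∃ f, IsMatch G f {x}ᶜ := by
  classical
  obtain ⟨M, hM⟩ := hG x
  have h := fun v : ({x}ᶜ : Set V) => hM.1 (hM.2 v)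
  choose g hg hu using h
  -- The value at `x` is a dummy, since `IsMatch` only constrains `f` on the given set.
  refine ⟨fun v => if hv : v ∈ ({x}ᶜ : Set V) then g ⟨v, hv⟩ else v, fun v hv => ?_⟩
  have h2 : (g ⟨v, hv⟩ : V) ∈ ({x}ᶜ : Set V) := (g ⟨v, hv⟩).2
  refine ⟨by simp only [dif_pos hv, h2], ?_, ?_⟩
  · simp only [dif_pos hv]
    have := (hg ⟨v, hv⟩).adj_sub
    simpa using this
  · simp only [dif_pos hv, dif_pos h2]
    have := hu (g ⟨v, hv⟩) ⟨v, hv⟩ (hg ⟨v, hv⟩).symm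
    exact congrArg Subtype.val this.symm

/-- A connected component parametrised by a path. -/
theorem component_iso_path {F : SimpleGraph V} {n : ℕ} (ψ : Fin n → V)
    (hψ : Function.Injective ψ)
    (hadj : ∀ i j, F.Adj (ψ i) (ψ j) ↔ (pathGraph n).Adj i j)
    (hcl : ∀ i v, F.Adj (ψ i) v → v ∈ Set.range ψ) (i₀ : Fin n) :
    Nonempty ((F.connectedComponentMk (ψ i₀)).toSimpleGraph ≃g pathGraph n) := by
  have hpre : ∀ i j, F.Reachable (ψ i) (ψ j) := fun i j =>
    ((pathGraph_preconnected n) i j).map (⟨ψ, fun {a b} h => (hadj a b).2 h⟩ : pathGraph n →g F)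
  have hr : ∀ i v, F.Reachable (ψ i) v → v ∈ Set.range ψ := by
    rintro i v ⟨w⟩
    generalize hu : ψ i = u at w
    induction w generalizing i with
    | nil => exact ⟨i, hu⟩
    | cons h w ih =>
      subst hu
      obtain ⟨j, rfl⟩ := hcl _ _ h
      exact ih j rfl
  let φ : Fin n → (F.connectedComponentMk (ψ i₀)) := fun i =>
    ⟨ψ i, ConnectedComponent.sound (hpre i i₀)⟩
  have hφ : Function.Bijective φ := by
    refine ⟨fun i j h => hψ (congrArg Subtype.val h), ?_⟩
    rintro ⟨v, hv⟩
    obtain ⟨i, rfl⟩ := hr i₀ v (ConnectedComponent.exact hv).symm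
    exact ⟨i, rfl⟩
  exact ⟨(⟨Equiv.ofBijective φ hφ, fun {a b} => hadj a b⟩ : pathGraph n ≃g _).symm⟩

/-- The spanning subgraph keeps only the consecutive edges of the path and the matching edges off
it, so chords of `G` do not spoil its components. -/
theorem noNicePath_of_not_hasPathFactor (h : ¬ HasPathFactor {2, 9} G) : NoNicePath G := by
  intro l hl hnd hc f hf
  apply h
  obtain ⟨ψ, rfl⟩ : ∃ ψ : Fin 9 → V, l = List.ofFn ψ := by
    refine ⟨fun i => l[(i : ℕ)]'(by omega), List.ext_getElem (by simp [hl]) fun n h₁ h₂ => ?_⟩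
    rw [List.getElem_ofFn]
  have hψ : Function.Injective ψ := List.nodup_ofFn.1 hnd
  simp only [List.mem_ofFn] at hf
  have hmem : ∀ v, v ∈ {v | ¬ ∃ i, ψ i = v} ↔ v ∉ Set.range ψ := fun v => Iff.rfl
  have hstep : ∀ i j : Fin 9, (i : ℕ) + 1 = j → G.Adj (ψ i) (ψ j) := by
    intro i j hij
    rw [List.isChain_iff_getElem] at hc
    have := hc i (by simp; omega)
    simp only [List.getElem_ofFn] at this
    have hj : j = ⟨(i : ℕ) + 1, by omega⟩ := Fin.ext hij.symm
    rwa [hj]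
  let F : SimpleGraph V :=
    { Adj := fun a b => (∃ i j, ψ i = a ∧ ψ j = b ∧ (pathGraph 9).Adj i j) ∨
        (a ∉ Set.range ψ ∧ b ∉ Set.range ψ ∧ f a = b)
      symm := ⟨by
        rintro a b (⟨i, j, hi, hj, h⟩ | ⟨ha, hb, h⟩)
        · exact Or.inl ⟨j, i, hj, hi, h.symm⟩
        · exact Or.inr ⟨hb, ha, by rw [← h]; exact (hf a ha).2.2⟩⟩
      loopless := ⟨by
        rintro a (⟨i, j, hi, hj, h⟩ | ⟨ha, hb, h⟩)
        · exact h.ne (hψ (hi.trans hj.symm))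
        · have := (hf a ha).2.1
          rw [h] at this
          exact this.ne rfl⟩ }
  refine ⟨F, ?_, ?_⟩
  · rintro a b (⟨i, j, rfl, rfl, h⟩ | ⟨ha, hb, rfl⟩)
    · rw [pathGraph_adj] at h
      rcases h with h | h
      · exact hstep _ _ h
      · exact (hstep _ _ h).symm
    · exact (hf a ha).2.1
  · intro C
    induction C using ConnectedComponent.ind with | h v =>
    by_cases hv : v ∈ Set.range ψ
    · obtain ⟨i, rfl⟩ := hv
      refine ⟨9, by simp, component_iso_path ψ hψ ?_ ?_ i⟩
      · intro i j
        constructor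
        · rintro (⟨i', j', hi, hj, h⟩ | ⟨ha, -⟩)
          · rwa [← hψ hi, ← hψ hj]
          · exact absurd ⟨i, rfl⟩ ha
        · intro h
          exact Or.inl ⟨i, j, rfl, rfl, h⟩
      · rintro i v (⟨i', j', hi, hj, h⟩ | ⟨ha, -⟩)
        · exact ⟨j', hj⟩
        · exact absurd ⟨i, rfl⟩ ha
    · have h1 := hf v hv
      have hne := h1.2.1.ne
      have h1' : f v ∉ Set.range ψ := h1.1
      refine ⟨2, by simp, component_iso_path (F := F) (n := 2) ![v, f v] ?_ ?_ ?_ 0⟩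
      · intro i j
        fin_cases i <;> fin_cases j <;> simp [hne, hne.symm]
      · have hF : F.Adj v (f v) := Or.inr ⟨hv, h1', rfl⟩
        intro i j
        fin_cases i <;> fin_cases j <;> simp [pathGraph_adj, hF, hF.symm]
      · rw [Fin.forall_fin_two]
        constructor
        · rintro w (⟨i', j', hi, hj, h⟩ | ⟨-, -, h⟩)
          · exact absurd ⟨i', hi⟩ hv
          · exact ⟨1, h⟩
        · rintro w (⟨i', j', hi, hj, h⟩ | ⟨-, -, h⟩)
          · exact absurd ⟨i', hi⟩ h1'
          · exact ⟨0, h1.2.2.symm.trans h⟩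

end Matching

/-! ### Alternating paths and the short odd cycles they close up to. -/

section Cycles

variable {V : Type*} {G : SimpleGraph V}

/-- The alternating orbit of two involutions with a single fixed point each. -/
theorem exists_alternating_orbit [Finite V] {f g : V → V} {x a : V}
    (hf : Function.Involutive f) (hg : Function.Involutive g)
    (hfx : ∀ v, f v = v ↔ v = x) (hga : ∀ v, g v = v ↔ v = a) :
    ∃ (y : ℤ → V) (k : ℕ), y 0 = x ∧ y k = a ∧ (∀ i, f (y i) = y (-i)) ∧
      (∀ i, g (y i) = y (-i - 1)) ∧ ∀ i j, y i = y j ↔ (2 * k + 1 : ℤ) ∣ i - j := by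
  let F : Equiv.Perm V := hf.toPerm
  let K : Equiv.Perm V := hg.toPerm
  have hFF : F⁻¹ = F := rfl
  have hKK : K⁻¹ = K := rfl
  let σ : Equiv.Perm V := F * K
  let y : ℤ → V := fun i => (σ ^ i) x
  have hy0 : y 0 = x := by simp [y]
  -- The two involutions act dihedrally on the orbit of `x`: `f` reflects indices about 0, `g` about
  -- -1/2.
  have hconj : ∀ i : ℤ, F * σ ^ i = σ ^ (-i) * F := by
    intro i
    have h1 : F * σ * F⁻¹ = σ⁻¹ := by
      simp only [σ, mul_inv_rev, hKK]
      rw [← mul_assoc, show F * F = 1 from mul_eq_one_iff_eq_inv.2 hFF.symm, one_mul, hFF]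
    have h2 : F * σ ^ i * F⁻¹ = σ ^ (-i) := by rw [← conj_zpow, h1, inv_zpow, zpow_neg]
    rw [← h2]; simp
  have hfy : ∀ i, f (y i) = y (-i) := by
    intro i
    have h := congrArg (fun τ : Equiv.Perm V => τ x) (hconj i)
    simp only [Equiv.Perm.mul_apply] at h
    have hx : F x = x := (hfx x).2 rfl
    rw [hx] at h
    exact h
  have hgy : ∀ i, g (y i) = y (-i - 1) := by
    intro i
    have h1 : y (i + 1) = f (g (y i)) := by
      simp only [y, add_comm i 1, zpow_add, zpow_one, Equiv.Perm.mul_apply]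
      rfl
    rw [← hf (g (y i)), ← h1, hfy]
    congr 1; ring
  have hy : ∀ i j, y i = y j ↔ (Function.minimalPeriod (σ • ·) x : ℤ) ∣ i - j := by
    intro i j
    rw [← MulAction.zpow_smul_eq_iff_minimalPeriod_dvd]
    simp only [y, Equiv.Perm.smul_def]
    rw [sub_eq_add_neg, add_comm, zpow_add, Equiv.Perm.mul_apply, zpow_neg,
      Equiv.Perm.inv_eq_iff_eq]
  have hpos : 0 < Function.minimalPeriod (σ • ·) x := by
    apply Function.minimalPeriod_pos_of_mem_periodicPts
    exact (MulAction.injective σ).mem_periodicPts x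
  generalize Function.minimalPeriod (σ • ·) x = n at hy hpos
  obtain ⟨k, hk | hk⟩ := n.even_or_odd'
  -- With even period `2k`, the point `y k` would be a second fixed point of `f`; with odd period
  -- `2k + 1`, `y k` is the fixed point of `g`.
  · exfalso
    have h1 : y (k : ℤ) = x := by
      rw [← hfx, hfy, hy]
      exact ⟨-1, by push_cast [hk]; ring⟩
    rw [← hy0, hy] at h1
    have := Int.le_of_dvd (by omega) h1
    omega
  · refine ⟨y, k, hy0, ?_, hfy, hgy, ?_⟩
    · rw [← hga, hgy, hy]
      exact ⟨-1, by push_cast [hk]; ring⟩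
    · intro i j
      rw [hy, hk]
      push_cast
      rfl

theorem IsMatch.exists_involutive {f : V → V} {x : V} (hf : IsMatch G f {x}ᶜ) :
    ∃ f' : V → V, Function.Involutive f' ∧ (∀ v, f' v = v ↔ v = x) ∧
      ∀ v, v ≠ x → f' v = f v := by
  classical
  refine ⟨fun v => if v = x then x else f v, ?_, ?_, ?_⟩
  · intro v
    by_cases hv : v = x
    · simp [hv]
    · have := hf v hv
      have h2 : f v ≠ x := this.1
      simp [hv, h2, this.2.2]
  · intro v
    by_cases hv : v = x
    · simp [hv]
    · have := (hf v hv).2.1.ne.symm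
      simp [hv, this]
  · intro v hv
    simp [hv]

/-- The alternating path between the vertices missed by two near-perfect matchings. -/
theorem exists_alternating_path [Finite V] (hG : Hypomatchable G) {f : V → V} {x : V}
    (hf : IsMatch G f {x}ᶜ) (a : V) :
    ∃ (y : ℤ → V) (k : ℕ), y 0 = x ∧ y k = a ∧ (∀ i, y i ≠ x → f (y i) = y (-i)) ∧
      (∀ i, y i ≠ x → G.Adj (y i) (y (-i))) ∧ (∀ i, y i ≠ a → G.Adj (y i) (y (-i - 1))) ∧
      ∀ i j, y i = y j ↔ (2 * k + 1 : ℤ) ∣ i - j := by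
  obtain ⟨g, hg⟩ := hG.exists_isMatch a
  obtain ⟨f', hf1, hf2, hf3⟩ := hf.exists_involutive
  obtain ⟨g', hg1, hg2, hg3⟩ := hg.exists_involutive
  obtain ⟨y, k, h0, hk, hfy, hgy, hy⟩ := exists_alternating_orbit hf1 hg1 hf2 hg2
  refine ⟨y, k, h0, hk, ?_, ?_, ?_, hy⟩
  · intro i hi
    rw [← hf3 _ hi, hfy]
  · intro i hi
    rw [← hfy, hf3 _ hi]
    exact (hf _ hi).2.1
  · intro i hi
    rw [← hgy, hg3 _ hi]
    exact (hg _ hi).2.1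

/-- The alternating path between the vertices missed by two near-perfect matchings joins any two
vertices. -/
theorem Hypomatchable.preconnected [Finite V] (hG : Hypomatchable G) : G.Preconnected := by
  intro x a
  obtain ⟨f, hf⟩ := hG.exists_isMatch x
  obtain ⟨y, k, h0, hk, -, h1, h2, -⟩ := exists_alternating_path hG hf a
  -- The second alternative absorbs an early visit to `a`, where the second matching provides no
  -- edge.
  have hr : ∀ j : ℕ, j ≤ k → G.Reachable x (y j) ∨ G.Reachable x a := by
    intro j
    induction j with
    | zero => intro _; left; simp [h0]
    | succ j ih =>
      intro hj
      rcases ih (by omega) with h | h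
      · by_cases ha : y j = a
        · right; rwa [← ha]
        · left
          have h3 := h.trans (h2 _ ha).reachable
          by_cases hx : y (-(j : ℤ) - 1) = x
          · have e : (-(j : ℤ) - 1) = -((j + 1 : ℕ) : ℤ) := by push_cast; ring
            by_cases hx' : y ((j + 1 : ℕ) : ℤ) = x
            · rw [hx']
            · have := (h1 _ hx').symm.reachable
              rw [← e] at this
              exact h3.trans this
          · have h4 := (h1 _ hx).reachable
            have e : -(-(j : ℤ) - 1) = ((j + 1 : ℕ) : ℤ) := by push_cast; ring
            rw [e] at h4
            exact h3.trans h4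
      · exact Or.inr h
  rcases hr k le_rfl with h | h
  · rwa [hk] at h
  · exact h

theorem SimpleGraph.Preconnected.exists_crossing (hG : G.Preconnected) {S : Set V}
    {a b : V} (ha : a ∈ S) (hb : b ∉ S) : ∃ u ∈ S, ∃ v ∉ S, G.Adj u v := by
  obtain ⟨w⟩ := hG a b
  obtain ⟨d, -, h1, h2⟩ := w.exists_boundary_dart S ha hb
  exact ⟨_, h1, _, h2, d.adj⟩

/-- Minimum degree at least two: deleting one neighbour still leaves `v` matched. -/
theorem Hypomatchable.exists_adj_ne (hG : Hypomatchable G) {v w : V} (h : v ≠ w) :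
    ∃ u, u ≠ w ∧ G.Adj v u := by
  obtain ⟨f, hf⟩ := hG.exists_isMatch w
  exact ⟨f v, (hf v h).1, (hf v h).2.1⟩

/-- A cycle of `G` whose complement is perfectly matched by `f`. -/
structure NiceCycle (G : SimpleGraph V) {n : ℕ} (p : ZMod n → V) (f : V → V) : Prop where
  inj : Function.Injective p
  adj : ∀ i, G.Adj (p i) (p (i + 1))
  isMatch : IsMatch G f (Set.range p)ᶜ

theorem NiceCycle.rotate {n : ℕ} {p : ZMod n → V} {f : V → V} (h : NiceCycle G p f)
    (k : ZMod n) : NiceCycle G (fun i => p (i + k)) f where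
  inj := h.inj.comp (add_left_injective k)
  adj i := by
    have := h.adj (i + k)
    rwa [add_right_comm] at this
  isMatch := by
    have : Set.range (fun i => p (i + k)) = Set.range p :=
      (Equiv.addRight k).surjective.range_comp p
    rw [this]
    exact h.isMatch

/-- By connectedness some outside vertex `c` is adjacent to the cycle; entering through `f c`, `c`
and going once round gives nine vertices. -/
theorem NoNicePath.not_niceCycle_seven [Fintype V] (hP : NoNicePath G) (hG : Hypomatchable G)
    (hcard : 9 ≤ Fintype.card V) (p : ZMod 7 → V) (f : V → V) : ¬ NiceCycle G p f := by
  intro h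
  obtain ⟨b, hb⟩ : ∃ b, b ∉ Set.range p := by
    by_contra! hs
    have := Fintype.card_le_of_surjective p hs
    simp [ZMod.card] at this
    omega
  obtain ⟨-, ⟨k, rfl⟩, c, hc, hadj⟩ :=
    hG.preconnected.exists_crossing (Set.mem_range_self (0 : ZMod 7)) hb
  have h' := h.rotate k
  obtain ⟨hd, hcd, hdc⟩ := h.isMatch c hc
  have hc' : ∀ i, p i ≠ c := fun i hi => hc ⟨i, hi⟩
  have hd' : ∀ i, p i ≠ f c := fun i hi => hd ⟨i, hi⟩
  have hne := hcd.ne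
  refine hP [f c, c, p (0 + k), p (1 + k), p (2 + k), p (3 + k), p (4 + k), p (5 + k), p (6 + k)]
    rfl ?_ ?_ f ?_
  · have hi := h'.inj
    have hi' : ∀ i j, p (i + k) = p (j + k) ↔ i = j := fun i j => hi.eq_iff
    simp only [List.nodup_cons, List.mem_cons, hi', List.not_mem_nil, (hc' _).symm, (hd' _).symm,
      hne.symm, or_false, not_false_iff, List.nodup_nil, and_true, true_and]
    decide
  · simp only [List.isChain_cons_cons, List.isChain_singleton, and_true]
    refine ⟨hcd.symm, by simpa using hadj.symm, ?_⟩
    exact ⟨h'.adj 0, h'.adj 1, h'.adj 2, h'.adj 3, h'.adj 4, h'.adj 5⟩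
  · have hr : ∀ v, v ∉ [f c, c, p (0 + k), p (1 + k), p (2 + k), p (3 + k), p (4 + k), p (5 + k),
        p (6 + k)] ↔ v ∉ Set.range p ∧ v ≠ c ∧ v ≠ f c := by
      intro v
      have : v ∈ Set.range p ↔ ∃ i : ZMod 7, p (i + k) = v :=
        ⟨fun ⟨i, hi⟩ => ⟨i - k, by simpa using hi⟩, fun ⟨i, hi⟩ => ⟨_, hi⟩⟩
      rw [this]
      have h7 : (∃ i : ZMod 7, p (i + k) = v) ↔ p (0 + k) = v ∨ p (1 + k) = v ∨ p (2 + k) = v ∨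
          p (3 + k) = v ∨ p (4 + k) = v ∨ p (5 + k) = v ∨ p (6 + k) = v := by
        constructor
        · rintro ⟨i, hi⟩
          have : i = 0 ∨ i = 1 ∨ i = 2 ∨ i = 3 ∨ i = 4 ∨ i = 5 ∨ i = 6 := by
            clear hi; revert i; decide
          rcases this with rfl | rfl | rfl | rfl | rfl | rfl | rfl <;> simp only [hi, true_or, or_true]
        · rintro (h | h | h | h | h | h | h) <;> exact ⟨_, h⟩
      rw [h7]
      simp only [List.mem_cons, List.not_mem_nil, or_false]
      grind
    refine h.isMatch.subset (fun v hv => ((hr v).1 hv).1) fun v hv => ?_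
    have h1 := (hr v).1 hv
    have h2 := h.isMatch v h1.1
    refine (hr _).2 ⟨h2.1, ?_, ?_⟩
    · intro e; apply h1.2.2; rw [← e, h2.2.2]
    · intro e; apply h1.2.1; rw [← h2.2.2, e, hdc]

/-- An edge at the vertex `x` missed by a matching lies in a triangle or in a nice `5`-cycle. -/
theorem blossom [Fintype V] (hP : NoNicePath G) (hG : Hypomatchable G)
    (hcard : 9 ≤ Fintype.card V) {f : V → V} {x a : V} (hf : IsMatch G f {x}ᶜ)
    (hxa : G.Adj x a) : G.Adj x (f a) ∨ ∃ p : ZMod 5 → V, NiceCycle G p f := by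
  obtain ⟨y, k, h0, hk, hfy, h1, h2, hy⟩ := exists_alternating_path hG hf a
  have hx : ∀ i, y i = x ↔ (2 * k + 1 : ℤ) ∣ i := by
    intro i; rw [← h0, hy, sub_zero]
  have ha : ∀ i, y i = a ↔ (2 * k + 1 : ℤ) ∣ i - k := by
    intro i; rw [← hk, hy]
  -- Since `f` negates indices, deleting a set of orbit points that contains `x` and is symmetric
  -- under negation leaves a set matched by `f`.
  have hm : ∀ S : Set V, (∀ v, v ∈ S → ∃ i, v = y i) → (∀ i, y i ∈ S → y (-i) ∈ S) →
      x ∈ S → IsMatch G f Sᶜ := by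
    intro S hl1 hl2 hxl
    have hsub : Sᶜ ⊆ {x}ᶜ := fun v hv e => hv (by rw [Set.mem_singleton_iff] at e; rwa [e])
    refine hf.subset hsub fun v hv => ?_
    intro hfv
    obtain ⟨i, hi⟩ := hl1 _ hfv
    have h3 := hf v (hsub hv)
    have h4 : f (y i) = v := by rw [← hi, h3.2.2]
    have h5 : y i ≠ x := by rw [← hi]; exact h3.1
    rw [hfy i h5] at h4
    apply hv
    rw [← h4]
    exact hl2 i (hi ▸ hfv)
  have hneg : ∀ i j, y i = y j → y (-i) = y (-j) := by
    intro i j h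
    rw [hy] at h ⊢
    rwa [← dvd_neg, show -(-i - -j) = i - j by ring]
  have hn : ∀ i : ℤ, 0 < i → i < 2 * k + 1 → ¬ (2 * k + 1 : ℤ) ∣ i := fun i hi hlt hd =>
    absurd (Int.le_of_dvd hi hd) (by omega)
  have hn' : ∀ i : ℤ, 0 < -i → -i < 2 * k + 1 → ¬ (2 * k + 1 : ℤ) ∣ i := fun i hi hlt hd =>
    hn (-i) hi hlt ((dvd_neg).2 hd)
  -- Here `c` lists the orbit indices in cyclic order, and `r` is the permutation of positions that
  -- realises negation.
  have hcyc : ∀ (m : ℕ) (c : ZMod m → ℤ) (r : ZMod m → ZMod m), (∀ i, c (r i) = - c i) → c 0 = 0 →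
      (∀ i j, (2 * k + 1 : ℤ) ∣ c i - c j → i = j) →
      (∀ i, G.Adj (y (c i)) (y (c (i + 1)))) → NiceCycle G (y ∘ c) f := by
    intro m c r hc1 hi₀ hc2 hc3
    refine ⟨fun i j hij => hc2 i j ((hy _ _).1 hij), hc3, hm _ ?_ ?_ ?_⟩
    · rintro - ⟨i, rfl⟩; exact ⟨c i, rfl⟩
    · rintro i ⟨j, hj⟩
      refine ⟨r j, ?_⟩
      have := hneg _ _ hj
      rwa [← hc1 j] at this
    · exact ⟨0, by simp [hi₀, h0]⟩
  have e1 : ∀ i : ℤ, 0 < i → i < 2 * k + 1 → G.Adj (y (-i)) (y i) := by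
    intro i h3 h4
    have := h1 i (fun h => hn i h3 h4 ((hx _).1 h))
    exact this.symm
  have e2 : ∀ i : ℤ, 0 ≤ i → i < k → G.Adj (y i) (y (-i - 1)) := by
    intro i h3 h4
    exact h2 i (fun h => hn' (i - k) (by omega) (by omega) ((ha _).1 h))
  have hax : G.Adj (y k) (y 0) := by rw [h0, hk]; exact hxa.symm
  -- The alternating path visits the indices 0, -1, 1, -2, 2, …; its first nine are exactly -4, …,
  -- 4, a symmetric set, distinct modulo `2k + 1` when `k ≥ 4`.
  have hk4 : k < 4 := by
    by_contra! hk4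
    refine hP (([0, -1, 1, -2, 2, -3, 3, -4, 4] : List ℤ).map y) rfl ?_ ?_ f ?_
    · refine List.Nodup.map_on ?_ (by decide)
      intro i hi j hj hij
      rw [hy] at hij
      have hb : ∀ i ∈ ([0, -1, 1, -2, 2, -3, 3, -4, 4] : List ℤ), -4 ≤ i ∧ i ≤ 4 := by decide
      have := Int.eq_zero_of_abs_lt_dvd hij (by
        have := hb i hi; have := hb j hj; rw [abs_lt]; omega)
      omega
    · rw [List.isChain_map]
      simp only [List.isChain_cons_cons, List.isChain_singleton, and_true]
      exact ⟨e2 0 (by omega) (by omega), e1 1 (by omega) (by omega), e2 1 (by omega) (by omega),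
        e1 2 (by omega) (by omega), e2 2 (by omega) (by omega), e1 3 (by omega) (by omega),
        e2 3 (by omega) (by omega), e1 4 (by omega) (by omega)⟩
    · refine hm {v | v ∈ ([0, -1, 1, -2, 2, -3, 3, -4, 4] : List ℤ).map y} ?_ ?_ ?_
      · intro v hv
        obtain ⟨i, -, rfl⟩ := List.mem_map.1 hv
        exact ⟨i, rfl⟩
      · intro i hi
        obtain ⟨j, hj, hij⟩ := List.mem_map.1 hi
        refine List.mem_map.2 ⟨-j, ?_, hneg _ _ hij⟩
        clear hij; revert j; decide
      · exact List.mem_map.2 ⟨0, by decide, h0⟩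
  -- Replaces the modulus by a numeral, so that distinctness can be decided.
  have hdvd : ∀ (m : ℕ) (_ : (2 * k + 1 : ℤ) = m) (c : ZMod m → ℤ),
      (∀ i j, (m : ℤ) ∣ c i - c j → i = j) → ∀ i j, (2 * k + 1 : ℤ) ∣ c i - c j → i = j := by
    intro m hm c hc i j hij
    rw [hm] at hij
    exact hc i j hij
  interval_cases k
  · exact absurd (h0.symm.trans hk) hxa.ne
  · left
    have hay : y 1 ≠ x := fun h => hn 1 (by omega) (by omega) ((hx _).1 h)
    have : f a = y (-1) := by rw [← hk]; exact hfy _ hay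
    rw [this, ← h0]
    exact e2 0 (by omega) (by omega)
  · right
    refine ⟨_, hcyc 5 ![0, -1, 1, -2, 2] ![0, 2, 1, 4, 3] (by decide) (by decide)
      (hdvd 5 (by norm_num) _ (by decide)) ?_⟩
    have h5 : ∀ q : ZMod 5 → Prop, q 0 → q 1 → q 2 → q 3 → q 4 → ∀ i, q i := by
      intro q a b c d e i; fin_cases i <;> assumption
    exact h5 _ (e2 0 (by omega) (by omega)) (e1 1 (by omega) (by omega))
      (e2 1 (by omega) (by omega)) (e1 2 (by omega) (by omega)) hax
  · exfalso
    refine hP.not_niceCycle_seven hG hcard _ f (hcyc 7 ![0, -1, 1, -2, 2, -3, 3]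
      ![0, 2, 1, 4, 3, 6, 5] (by decide) (by decide) (hdvd 7 (by norm_num) _ (by decide)) ?_)
    have h7 : ∀ q : ZMod 7 → Prop, q 0 → q 1 → q 2 → q 3 → q 4 → q 5 → q 6 → ∀ i, q i := by
      intro q a b c d e g h i; fin_cases i <;> assumption
    exact h7 _ (e2 0 (by omega) (by omega)) (e1 1 (by omega) (by omega))
      (e2 1 (by omega) (by omega)) (e1 2 (by omega) (by omega)) (e2 2 (by omega) (by omega))
      (e1 3 (by omega) (by omega)) hax

end Cycles

/-! ### Enumerating the vertices by the standard vertex set. -/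

section Labelling

open HypoFamilies Vertex

variable {V : Type*} {G : SimpleGraph V}

/-- The standard vertex set as a disjoint union. -/
def HypoFamilies.Vertex.equivSum (s₁ s₂ s₃ : ℕ) :
    Vertex s₁ s₂ s₃ ≃ Fin 3 ⊕ (Fin s₁ × Bool) ⊕ (Fin s₂ × Bool) ⊕ (Fin s₃ × Bool) where
  toFun
    | u₁ => .inl 0
    | u₂ => .inl 1
    | u₃ => .inl 2
    | x₁ j b => .inr (.inl (j, b))
    | v₁ j => .inr (.inr (.inl (j, false)))
    | v₃ j => .inr (.inr (.inl (j, true)))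
    | x₃ j b => .inr (.inr (.inr (j, b)))
  invFun
    | .inl 0 => u₁
    | .inl 1 => u₂
    | .inl 2 => u₃
    | .inr (.inl (j, b)) => x₁ j b
    | .inr (.inr (.inl (j, false))) => v₁ j
    | .inr (.inr (.inl (j, true))) => v₃ j
    | .inr (.inr (.inr (j, b))) => x₃ j b
  left_inv v := by cases v <;> rfl
  right_inv v := by
    rcases v with i | ⟨j, b⟩ | ⟨j, b⟩ | ⟨j, b⟩
    · fin_cases i <;> rfl
    · rfl
    · cases b <;> rfl
    · rfl

/-- An enumeration of `V` by the standard vertex set: `f` pairs up the vertices other than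
`u₁, u₂, u₃`, the pair `L_{i,j}` consists of vertices with label `i - 1`, and the vertices `v₁ j`
satisfy `P`. -/
structure IsLabelling (f : V → V) (t : V → Fin 3) (P : V → Prop) (w₁ w₂ w₃ : V) {s₁ s₂ s₃ : ℕ}
    (e : Vertex s₁ s₂ s₃ ≃ V) : Prop where
  e₁ : e u₁ = w₁
  e₂ : e u₂ = w₂
  e₃ : e u₃ = w₃
  t₁ : ∀ j b, t (e (x₁ j b)) = 0
  t₂ : ∀ j, t (e (v₁ j)) = 1
  t₂' : ∀ j, t (e (v₃ j)) = 1
  t₃ : ∀ j b, t (e (x₃ j b)) = 2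
  f₁ : ∀ j b, f (e (x₁ j b)) = e (x₁ j !b)
  f₂ : ∀ j, f (e (v₁ j)) = e (v₃ j)
  f₂' : ∀ j, f (e (v₃ j)) = e (v₁ j)
  f₃ : ∀ j b, f (e (x₃ j b)) = e (x₃ j !b)
  prop : ∀ j, P (e (v₁ j))

theorem exists_isLabelling [Fintype V] {w₁ w₂ w₃ : V} (h₁₂ : w₁ ≠ w₂) (h₁₃ : w₁ ≠ w₃)
    (h₂₃ : w₂ ≠ w₃) {f : V → V} (hf : IsMatch G f ({w₁, w₂, w₃}ᶜ : Set V)) (t : V → Fin 3)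
    (ht : ∀ v ∈ ({w₁, w₂, w₃}ᶜ : Set V), t (f v) = t v) (P : V → Prop)
    (hP : ∀ v ∈ ({w₁, w₂, w₃}ᶜ : Set V), t v = 1 → P v ∨ P (f v)) :
    ∃ (s₁ s₂ s₃ : ℕ) (e : Vertex s₁ s₂ s₃ ≃ V), IsLabelling f t P w₁ w₂ w₃ e ∧
      3 + 2 * (s₁ + s₂ + s₃) = Fintype.card V := by
  classical
  let r := Fintype.equivFin V
  -- `O` selects one end of each matched pair: the end satisfying `P` if exactly one does, otherwise
  -- the smaller in an arbitrary enumeration. The selected ends of pairs labelled 1 become the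
  -- vertices `v₁ j`.
  let O : V → Prop := fun v => v ∈ ({w₁, w₂, w₃}ᶜ : Set V) ∧
    ((P v ∧ ¬ P (f v)) ∨ ((P v ↔ P (f v)) ∧ r v < r (f v)))
  have hO1 : ∀ v ∈ ({w₁, w₂, w₃}ᶜ : Set V), O v ∨ O (f v) := by
    intro v hv
    obtain ⟨h1, h2, h3⟩ := hf v hv
    have : r v ≠ r (f v) := r.injective.ne h2.ne
    simp only [O, h3, hv, h1, true_and]
    rcases this.lt_or_gt with h | h <;> tauto
  have hO2 : ∀ v, O v → ¬ O (f v) := by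
    intro v hv hv'
    obtain ⟨h1, h2, h3⟩ := hf v hv.1
    simp only [O, h3, hv.1, h1, true_and] at hv hv'
    have : ¬ (r v < r (f v) ∧ r (f v) < r v) := fun h => lt_asymm h.1 h.2
    tauto
  let I : Fin 3 → Type _ := fun i => {v // O v ∧ t v = i}
  let E : ∀ i, Fin (Fintype.card (I i)) ≃ I i := fun i => (Fintype.equivFin (I i)).symm
  let W : ∀ i, Fin (Fintype.card (I i)) → Bool → V := fun i j b =>
    if b then f (E i j).1 else (E i j).1
  have hWmem : ∀ i j b, W i j b ∈ ({w₁, w₂, w₃}ᶜ : Set V) := by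
    intro i j b
    have h := (E i j).2.1.1
    cases b
    · exact h
    · exact (hf _ h).1
  have hWt : ∀ i j b, t (W i j b) = i := by
    intro i j b
    cases b
    · exact (E i j).2.2
    · exact (ht _ (E i j).2.1.1).trans (E i j).2.2
  have hWf : ∀ i j b, f (W i j b) = W i j !b := by
    intro i j b
    cases b
    · rfl
    · exact (hf _ (E i j).2.1.1).2.2
  have hWO : ∀ i j b, O (W i j b) ↔ b = false := by
    intro i j b
    have h := (E i j).2.1
    cases b
    · simpa [W] using h
    · simpa [W] using hO2 _ h
  have hWinj : ∀ i j j' b b', W i j b = W i j' b' → j = j' ∧ b = b' := by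
    intro i j j' b b' h
    have hb : b = b' := by
      have h1 := hWO i j b
      rw [h, hWO] at h1
      revert h1; cases b <;> cases b' <;> simp
    subst hb
    refine ⟨?_, rfl⟩
    have h0 : W i j false = W i j' false := by
      cases b
      · exact h
      · have := congrArg f h
        rwa [hWf, hWf] at this
    exact (E i).injective (Subtype.ext h0)
  have hWsurj : ∀ v ∈ ({w₁, w₂, w₃}ᶜ : Set V), ∃ j b, W (t v) j b = v := by
    intro v hv
    rcases hO1 v hv with h | h
    · exact ⟨(E (t v)).symm ⟨v, h, rfl⟩, false, by simp [W]⟩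
    · exact ⟨(E (t v)).symm ⟨f v, h, ht v hv⟩, true, by simp [W, (hf v hv).2.2]⟩
  have hWP : ∀ j, P (W 1 j false) := by
    intro j
    have h := (E 1 j).2
    have := hP _ h.1.1 h.2
    simp only [O] at h
    simp only [W]
    tauto
  let φ : Vertex (Fintype.card (I 0)) (Fintype.card (I 1)) (Fintype.card (I 2)) → V := fun v =>
    match v with
    | u₁ => w₁
    | u₂ => w₂
    | u₃ => w₃
    | x₁ j b => W 0 j b
    | v₁ j => W 1 j false
    | v₃ j => W 1 j true
    | x₃ j b => W 2 j b
  have hne : ∀ i j b, W i j b ≠ w₁ ∧ W i j b ≠ w₂ ∧ W i j b ≠ w₃ := by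
    intro i j b
    have := hWmem i j b
    simpa [not_or] using this
  have htne : ∀ i i' j j' b b', i ≠ i' → W i j b ≠ W i' j' b' := by
    intro i i' j j' b b' hi h
    apply hi
    rw [← hWt i j b, h, hWt]
  have hφ : Function.Bijective φ := by
    constructor
    · intro a b hab
      cases a <;> cases b <;> simp only [φ] at hab <;> first
        | rfl
        | exact absurd hab (by assumption)
        | exact absurd hab.symm (by assumption)
        | exact absurd hab (hne _ _ _).1
        | exact absurd hab (hne _ _ _).2.1
        | exact absurd hab (hne _ _ _).2.2
        | exact absurd hab.symm (hne _ _ _).1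
        | exact absurd hab.symm (hne _ _ _).2.1
        | exact absurd hab.symm (hne _ _ _).2.2
        | exact absurd hab (htne _ _ _ _ _ _ (by decide))
        | (obtain ⟨rfl, h⟩ := hWinj _ _ _ _ _ hab
           first | rfl | (subst h; rfl) | cases h)
    · intro v
      by_cases hv : v ∈ ({w₁, w₂, w₃}ᶜ : Set V)
      · obtain ⟨j, b, hj⟩ := hWsurj v hv
        generalize t v = i at j hj
        fin_cases i
        · exact ⟨x₁ j b, hj⟩
        · cases b
          · exact ⟨v₁ j, hj⟩
          · exact ⟨v₃ j, hj⟩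
        · exact ⟨x₃ j b, hj⟩
      · simp only [Set.mem_compl_iff, not_not, Set.mem_insert_iff, Set.mem_singleton_iff] at hv
        rcases hv with rfl | rfl | rfl
        · exact ⟨u₁, rfl⟩
        · exact ⟨u₂, rfl⟩
        · exact ⟨u₃, rfl⟩
  have hcard := Fintype.card_congr
    ((Vertex.equivSum _ _ _).symm.trans (Equiv.ofBijective φ hφ))
  refine ⟨_, _, _, Equiv.ofBijective φ hφ, ⟨rfl, rfl, rfl, fun j b => hWt 0 j b,
    fun j => hWt 1 j false, fun j => hWt 1 j true, fun j b => hWt 2 j b, fun j b => hWf 0 j b,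
    fun j => hWf 1 j false, fun j => hWf 1 j true, fun j b => hWf 2 j b, hWP⟩, ?_⟩
  simp only [Fintype.card_sum, Fintype.card_fin, Fintype.card_prod, Fintype.card_bool] at hcard
  omega

end Labelling

/-! ### Comparing labelled graphs with the extremal graphs. -/

section Families

open HypoFamilies Vertex

variable {V : Type*} {G : SimpleGraph V}

theorem fromRel_le {r : V → V → Prop} (h : ∀ a b, r a b → a ≠ b → G.Adj a b) :
    SimpleGraph.fromRel r ≤ G := by
  intro a b hab
  rw [fromRel_adj] at hab
  obtain ⟨hne, h1 | h1⟩ := hab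
  · exact h a b h1 hne
  · exact (h b a h1 hne.symm).symm

theorem joinTo_le {u : V} {S : Set V} (h : ∀ b ∈ S, G.Adj u b) : joinTo u S ≤ G :=
  fromRel_le fun _ b hab _ => hab.1 ▸ h b hab.2

theorem edge_le {u v : V} (h : G.Adj u v) : SimpleGraph.edge u v ≤ G := by
  intro a b hab
  rw [edge_adj] at hab
  rcases hab with ⟨⟨rfl, rfl⟩ | ⟨rfl, rfl⟩, -⟩
  · exact h
  · exact h.symm

variable {s₁ s₂ s₃ : ℕ}

theorem base_le {H : SimpleGraph (Vertex s₁ s₂ s₃)} (h₁₂ : H.Adj u₁ u₂) (h₂₃ : H.Adj u₂ u₃)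
    (h₁ : ∀ j, H.Adj (x₁ j false) (x₁ j true)) (h₂ : ∀ j, H.Adj (v₁ j) (v₃ j))
    (h₃ : ∀ j, H.Adj (x₃ j false) (x₃ j true)) : base s₁ s₂ s₃ ≤ H := by
  refine fromRel_le ?_
  rintro - - (_ | _ | j | j | j) -
  · exact h₁₂
  · exact h₂₃
  · exact h₁ j
  · exact h₂ j
  · exact h₃ j

/-- Every edge lies inside `Q` or has an end outside it, so controlling neighbourhoods outside `Q`
leaves only three pairs to check. -/
theorem le_of_cases {H A : SimpleGraph (Vertex s₁ s₂ s₃)} (h₁₂ : H.Adj u₁ u₂ → A.Adj u₁ u₂)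
    (h₁₃ : H.Adj u₁ u₃ → A.Adj u₁ u₃) (h₂₃ : H.Adj u₂ u₃ → A.Adj u₂ u₃)
    (hx₁ : ∀ j b z, H.Adj (x₁ j b) z → A.Adj (x₁ j b) z)
    (hv₁ : ∀ j z, H.Adj (v₁ j) z → A.Adj (v₁ j) z)
    (hv₃ : ∀ j z, H.Adj (v₃ j) z → A.Adj (v₃ j) z)
    (hx₃ : ∀ j b z, H.Adj (x₃ j b) z → A.Adj (x₃ j b) z) : H ≤ A := by
  intro a b h
  have h' := h.symm
  cases a with
  | x₁ j e => exact hx₁ _ _ _ h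
  | v₁ j => exact hv₁ _ _ h
  | v₃ j => exact hv₃ _ _ h
  | x₃ j e => exact hx₃ _ _ _ h
  | _ =>
    cases b with
    | x₁ j e => exact (hx₁ _ _ _ h').symm
    | v₁ j => exact (hv₁ _ _ h').symm
    | v₃ j => exact (hv₃ _ _ h').symm
    | x₃ j e => exact (hx₃ _ _ _ h').symm
    | _ =>
      first
        | exact absurd rfl h.ne
        | exact h₁₂ h
        | exact h₁₃ h
        | exact h₂₃ h
        | exact (h₁₂ h').symm
        | exact (h₁₃ h').symm
        | exact (h₂₃ h').symm

theorem base_le_A₁ : base s₁ s₂ s₃ ≤ A₁ s₁ s₂ s₃ := by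
  unfold A₁
  exact le_sup_of_le_left (le_sup_of_le_left (le_sup_of_le_left le_sup_left))

theorem base_le_A₂min : base s₁ s₂ s₃ ≤ A₂min s₁ s₂ s₃ := by
  unfold A₂min
  exact le_sup_of_le_left le_sup_left

theorem base_le_A₂max : base s₁ s₂ s₃ ≤ A₂max s₁ s₂ s₃ := by
  unfold A₂max
  exact le_sup_of_le_left (le_sup_of_le_left le_sup_left)

theorem base_u₁_u₂ : (base s₁ s₂ s₃).Adj u₁ u₂ := by
  simp [base, BaseEdge.q₁₂]

theorem base_u₂_u₃ : (base s₁ s₂ s₃).Adj u₂ u₃ := by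
  simp [base, BaseEdge.q₂₃]

theorem base_x₁ (j b) : (base s₁ s₂ s₃).Adj (x₁ j b) (x₁ j !b) := by
  cases b <;> simp [base, BaseEdge.l₁]

theorem base_x₃ (j b) : (base s₁ s₂ s₃).Adj (x₃ j b) (x₃ j !b) := by
  cases b <;> simp [base, BaseEdge.l₃]

theorem base_v₁_v₃ (j) : (base s₁ s₂ s₃).Adj (v₁ j) (v₃ j) := by
  simp [base, BaseEdge.l₂]

variable {f : V → V} {t : V → Fin 3} {P : V → Prop} {w₁ w₂ w₃ : V} {e : Vertex s₁ s₂ s₃ ≃ V}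

theorem mem𝒢₁_of_isLabelling (he : IsLabelling f t P w₁ w₂ w₃ e) (hs : 3 ≤ s₁ + s₂ + s₃)
    (h₁₂ : G.Adj w₁ w₂) (h₁₃ : G.Adj w₁ w₃) (h₂₃ : G.Adj w₂ w₃)
    (hv : ∀ v, v ≠ w₁ → v ≠ w₂ → v ≠ w₃ → ∀ z, G.Adj v z ↔ z = f v ∨ z = ![w₁, w₂, w₃] (t v)) :
    Mem𝒢₁ G := by
  have key : ∀ a, a ≠ u₁ → a ≠ u₂ → a ≠ u₃ → ∀ z, (G.comap e).Adj a z ↔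
      e z = f (e a) ∨ e z = ![w₁, w₂, w₃] (t (e a)) := by
    intro a h1 h2 h3 z
    refine hv (e a) ?_ ?_ ?_ (e z)
    · rw [← he.e₁]; exact e.injective.ne h1
    · rw [← he.e₂]; exact e.injective.ne h2
    · rw [← he.e₃]; exact e.injective.ne h3
  have kx₁ : ∀ j b z, (G.comap e).Adj (x₁ j b) z ↔ z = x₁ j !b ∨ z = u₁ := by
    intro j b z
    rw [key _ (by simp) (by simp) (by simp), he.f₁, he.t₁]
    simp [← he.e₁]
  have kv₁ : ∀ j z, (G.comap e).Adj (v₁ j) z ↔ z = v₃ j ∨ z = u₂ := by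
    intro j z
    rw [key _ (by simp) (by simp) (by simp), he.f₂, he.t₂]
    simp [← he.e₂]
  have kv₃ : ∀ j z, (G.comap e).Adj (v₃ j) z ↔ z = v₁ j ∨ z = u₂ := by
    intro j z
    rw [key _ (by simp) (by simp) (by simp), he.f₂', he.t₂']
    simp [← he.e₂]
  have kx₃ : ∀ j b z, (G.comap e).Adj (x₃ j b) z ↔ z = x₃ j !b ∨ z = u₃ := by
    intro j b z
    rw [key _ (by simp) (by simp) (by simp), he.f₃, he.t₃]
    simp [← he.e₃]
  have k₁₂ : (G.comap e).Adj u₁ u₂ := by simpa [he.e₁, he.e₂] using h₁₂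
  have k₁₃ : (G.comap e).Adj u₁ u₃ := by simpa [he.e₁, he.e₃] using h₁₃
  have k₂₃ : (G.comap e).Adj u₂ u₃ := by simpa [he.e₂, he.e₃] using h₂₃
  have hA : G.comap e = A₁ s₁ s₂ s₃ := by
    apply le_antisymm
    · refine le_of_cases (fun _ => base_le_A₁ base_u₁_u₂) (fun _ => by simp [A₁, edge_adj])
        (fun _ => base_le_A₁ base_u₂_u₃) ?_ ?_ ?_ ?_
      · intro j b z h
        rcases (kx₁ j b z).1 h with rfl | rfl
        · exact base_le_A₁ (base_x₁ j b)
        · cases b <;> simp [A₁, joinTo, L₁]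
      · intro j z h
        rcases (kv₁ j z).1 h with rfl | rfl
        · exact base_le_A₁ (base_v₁_v₃ j)
        · simp [A₁, joinTo, L₂]
      · intro j z h
        rcases (kv₃ j z).1 h with rfl | rfl
        · exact base_le_A₁ (base_v₁_v₃ j).symm
        · simp [A₁, joinTo, L₂]
      · intro j b z h
        rcases (kx₃ j b z).1 h with rfl | rfl
        · exact base_le_A₁ (base_x₃ j b)
        · cases b <;> simp [A₁, joinTo, L₃]
    · refine sup_le (sup_le (sup_le (sup_le (base_le k₁₂ k₂₃ ?_ ?_ ?_) (edge_le k₁₃))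
        (joinTo_le ?_)) (joinTo_le ?_)) (joinTo_le ?_)
      · exact fun j => (kx₁ _ _ _).2 (Or.inl rfl)
      · exact fun j => (kv₁ _ _).2 (Or.inl rfl)
      · exact fun j => (kx₃ _ _ _).2 (Or.inl rfl)
      · rintro - ⟨j, b, rfl⟩
        exact ((kx₁ _ _ _).2 (Or.inr rfl)).symm
      · rintro - ⟨j, rfl | rfl⟩
        · exact ((kv₁ _ _).2 (Or.inr rfl)).symm
        · exact ((kv₃ _ _).2 (Or.inr rfl)).symm
      · rintro - ⟨j, b, rfl⟩
        exact ((kx₃ _ _ _).2 (Or.inr rfl)).symm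
  exact ⟨s₁, s₂, s₃, hs, ⟨hA ▸ (Iso.comap e G).symm⟩⟩

/-- This lower bound serves 𝒢₂, 𝒢₃ and 𝒢₄ alike, since their minimal graphs are all built on
`A₂min`. -/
theorem IsLabelling.A₂min_le (he : IsLabelling f t P w₁ w₂ w₃ e)
    (hf : IsMatch G f ({w₁, w₂, w₃}ᶜ : Set V))
    (h₁₂ : G.Adj w₁ w₂) (h₂₃ : G.Adj w₂ w₃)
    (h₀ : ∀ v, v ≠ w₁ → v ≠ w₂ → v ≠ w₃ → t v = 0 → G.Adj w₁ v)
    (h₂ : ∀ v, v ≠ w₁ → v ≠ w₂ → v ≠ w₃ → t v = 2 → G.Adj w₃ v)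
    (hP : ∀ v, P v → G.Adj w₁ v ∧ G.Adj w₃ (f v)) : A₂min s₁ s₂ s₃ ≤ G.comap e := by
  have hout : ∀ a, a ≠ u₁ → a ≠ u₂ → a ≠ u₃ → e a ≠ w₁ ∧ e a ≠ w₂ ∧ e a ≠ w₃ := by
    intro a h1 h2 h3
    rw [← he.e₁, ← he.e₂, ← he.e₃]
    exact ⟨e.injective.ne h1, e.injective.ne h2, e.injective.ne h3⟩
  have hadj : ∀ a, a ≠ u₁ → a ≠ u₂ → a ≠ u₃ → G.Adj (e a) (f (e a)) := by
    intro a h1 h2 h3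
    refine (hf _ ?_).2.1
    simpa [not_or] using hout a h1 h2 h3
  refine sup_le (sup_le (base_le ?_ ?_ ?_ ?_ ?_) (joinTo_le ?_)) (joinTo_le ?_)
  · simpa [he.e₁, he.e₂] using h₁₂
  · simpa [he.e₂, he.e₃] using h₂₃
  · intro j
    have := hadj (x₁ j false) (by simp) (by simp) (by simp)
    rwa [he.f₁] at this
  · intro j
    have := hadj (v₁ j) (by simp) (by simp) (by simp)
    rwa [he.f₂] at this
  · intro j
    have := hadj (x₃ j false) (by simp) (by simp) (by simp)
    rwa [he.f₃] at this
  · rintro - (⟨j, b, rfl⟩ | ⟨j, rfl⟩)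
    · obtain ⟨h1, h2, h3⟩ := hout (x₁ j b) (by simp) (by simp) (by simp)
      simpa [he.e₁] using h₀ _ h1 h2 h3 (he.t₁ _ _)
    · simpa [he.e₁] using (hP _ (he.prop j)).1
  · rintro - (⟨j, b, rfl⟩ | ⟨j, rfl⟩)
    · obtain ⟨h1, h2, h3⟩ := hout (x₃ j b) (by simp) (by simp) (by simp)
      simpa [he.e₃] using h₂ _ h1 h2 h3 (he.t₃ _ _)
    · have := (hP _ (he.prop j)).2
      rw [he.f₂] at this
      simpa [he.e₃] using this

end Families

/-! ### Membership criteria for 𝒢₂, 𝒢₃ and 𝒢₄. -/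

section Families

open HypoFamilies Vertex

variable {V : Type*} {G : SimpleGraph V} {s₁ s₂ s₃ : ℕ}
  {f : V → V} {t : V → Fin 3} {P : V → Prop} {w₁ w₂ w₃ : V} {e : Vertex s₁ s₂ s₃ ≃ V}

theorem IsLabelling.apply_ne (he : IsLabelling f t P w₁ w₂ w₃ e) (a) (h1 : a ≠ u₁) (h2 : a ≠ u₂)
    (h3 : a ≠ u₃) : e a ≠ w₁ ∧ e a ≠ w₂ ∧ e a ≠ w₃ := by
  rw [← he.e₁, ← he.e₂, ← he.e₃]
  exact ⟨e.injective.ne h1, e.injective.ne h2, e.injective.ne h3⟩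

theorem IsLabelling.exists_x₁ (he : IsLabelling f t P w₁ w₂ w₃ e) {v : V} (h1 : v ≠ w₁)
    (h2 : v ≠ w₂) (h3 : v ≠ w₃) (hv : t v = 0) : ∃ j b, e (x₁ j b) = v := by
  obtain ⟨a, rfl⟩ := e.surjective v
  cases a with
  | u₁ => exact absurd he.e₁ h1
  | u₂ => exact absurd he.e₂ h2
  | u₃ => exact absurd he.e₃ h3
  | x₁ j b => exact ⟨j, b, rfl⟩
  | v₁ j => simp [he.t₂] at hv
  | v₃ j => simp [he.t₂'] at hv
  | x₃ j b => simp [he.t₃] at hv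

theorem IsLabelling.exists_v (he : IsLabelling f t P w₁ w₂ w₃ e) {v : V} (h1 : v ≠ w₁)
    (h2 : v ≠ w₂) (h3 : v ≠ w₃) (hv : t v = 1) : ∃ j, e (v₁ j) = v ∨ e (v₃ j) = v := by
  obtain ⟨a, rfl⟩ := e.surjective v
  cases a with
  | u₁ => exact absurd he.e₁ h1
  | u₂ => exact absurd he.e₂ h2
  | u₃ => exact absurd he.e₃ h3
  | x₁ j b => simp [he.t₁] at hv
  | v₁ j => exact ⟨j, Or.inl rfl⟩
  | v₃ j => exact ⟨j, Or.inr rfl⟩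
  | x₃ j b => simp [he.t₃] at hv

theorem IsLabelling.exists_x₃ (he : IsLabelling f t P w₁ w₂ w₃ e) {v : V} (h1 : v ≠ w₁)
    (h2 : v ≠ w₂) (h3 : v ≠ w₃) (hv : t v = 2) : ∃ j b, e (x₃ j b) = v := by
  obtain ⟨a, rfl⟩ := e.surjective v
  cases a with
  | u₁ => exact absurd he.e₁ h1
  | u₂ => exact absurd he.e₂ h2
  | u₃ => exact absurd he.e₃ h3
  | x₁ j b => simp [he.t₁] at hv
  | v₁ j => simp [he.t₂] at hv
  | v₃ j => simp [he.t₂'] at hv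
  | x₃ j b => exact ⟨j, b, rfl⟩

theorem IsLabelling.s₃_eq_zero (he : IsLabelling f t P w₁ w₂ w₃ e)
    (h : ∀ v, v ≠ w₁ → v ≠ w₂ → v ≠ w₃ → t v ≠ 2) : s₃ = 0 := by
  by_contra hs
  obtain ⟨h1, h2, h3⟩ := he.apply_ne (x₃ ⟨0, by omega⟩ false) (by simp) (by simp) (by simp)
  exact h _ h1 h2 h3 (he.t₃ _ _)

/-- When no mate of a vertex in `T` satisfies `P`, the orientation of the pairs is forced, and the
`v₁ j` enumerate exactly `T`. -/
theorem IsLabelling.s₂_eq_card (he : IsLabelling f t P w₁ w₂ w₃ e) (T : Finset V)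
    (hT : ∀ v, P v → v ∈ T)
    (hT' : ∀ v ∈ T, v ≠ w₁ ∧ v ≠ w₂ ∧ v ≠ w₃ ∧ t v = 1 ∧ ¬ P (f v)) : s₂ = T.card := by
  classical
  have : T = Finset.univ.image (fun j => e (v₁ j)) := by
    ext v
    simp only [Finset.mem_image, Finset.mem_univ, true_and]
    constructor
    · intro hv
      obtain ⟨h1, h2, h3, h4, h5⟩ := hT' v hv
      obtain ⟨j, rfl | rfl⟩ := he.exists_v h1 h2 h3 h4
      · exact ⟨j, rfl⟩
      · rw [he.f₂'] at h5
        exact absurd (he.prop j) h5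
    · rintro ⟨j, rfl⟩
      exact hT _ (he.prop j)
  rw [this, Finset.card_image_of_injective, Finset.card_univ, Fintype.card_fin]
  intro i j h
  simpa using h

theorem IsLabelling.mem𝒢₂ (he : IsLabelling f t P w₁ w₂ w₃ e) (hs₂ : 1 ≤ s₂)
    (hs : 3 ≤ s₁ + s₂ + s₃) (hs' : (1 ≤ s₁ ∧ 1 ≤ s₃) ∨ 2 ≤ s₂)
    (hmin : A₂min s₁ s₂ s₃ ≤ G.comap e)
    (h₀ : ∀ v, v ≠ w₁ → v ≠ w₂ → v ≠ w₃ → t v = 0 → ∀ z, G.Adj v z → z = f v ∨ z = w₁)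
    (h₁ : ∀ v, v ≠ w₁ → v ≠ w₂ → v ≠ w₃ → t v = 1 → ∀ z, G.Adj v z →
      z = f v ∨ z = w₁ ∨ z = w₃)
    (h₂ : ∀ v, v ≠ w₁ → v ≠ w₂ → v ≠ w₃ → t v = 2 → ∀ z, G.Adj v z → z = f v ∨ z = w₃) :
    Mem𝒢₂ G := by
  refine ⟨s₁, s₂, s₃, hs₂, hs, hs', G.comap e, hmin, ?_, ⟨(Iso.comap e G).symm⟩⟩
  refine le_of_cases (fun _ => base_le_A₂max base_u₁_u₂) (fun _ => by simp [A₂max, edge_adj])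
    (fun _ => base_le_A₂max base_u₂_u₃) ?_ ?_ ?_ ?_
  · intro j b z h
    obtain ⟨n1, n2, n3⟩ := he.apply_ne (x₁ j b) (by simp) (by simp) (by simp)
    have := h₀ _ n1 n2 n3 (he.t₁ _ _) _ h
    rw [he.f₁, ← he.e₁, e.injective.eq_iff, e.injective.eq_iff] at this
    rcases this with rfl | rfl
    · exact base_le_A₂max (base_x₁ j b)
    · cases b <;> simp [A₂max, joinTo, L₁]
  · intro j z h
    obtain ⟨n1, n2, n3⟩ := he.apply_ne (v₁ j) (by simp) (by simp) (by simp)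
    have := h₁ _ n1 n2 n3 (he.t₂ _) _ h
    rw [he.f₂, ← he.e₁, ← he.e₃, e.injective.eq_iff, e.injective.eq_iff, e.injective.eq_iff] at this
    rcases this with rfl | rfl | rfl
    · exact base_le_A₂max (base_v₁_v₃ j)
    · simp [A₂max, joinTo, L₂]
    · simp [A₂max, joinTo, L₂]
  · intro j z h
    obtain ⟨n1, n2, n3⟩ := he.apply_ne (v₃ j) (by simp) (by simp) (by simp)
    have := h₁ _ n1 n2 n3 (he.t₂' _) _ h
    rw [he.f₂', ← he.e₁, ← he.e₃, e.injective.eq_iff, e.injective.eq_iff, e.injective.eq_iff]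
      at this
    rcases this with rfl | rfl | rfl
    · exact base_le_A₂max (base_v₁_v₃ j).symm
    · simp [A₂max, joinTo, L₂]
    · simp [A₂max, joinTo, L₂]
  · intro j b z h
    obtain ⟨n1, n2, n3⟩ := he.apply_ne (x₃ j b) (by simp) (by simp) (by simp)
    have := h₂ _ n1 n2 n3 (he.t₃ _ _) _ h
    rw [he.f₃, ← he.e₃, e.injective.eq_iff, e.injective.eq_iff] at this
    rcases this with rfl | rfl
    · exact base_le_A₂max (base_x₃ j b)
    · cases b <;> simp [A₂max, joinTo, L₃]

/-- The upper bound is complete on the five vertices of `Q` and `L_{2,1}`, so chords there need no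
control. -/
theorem IsLabelling.mem𝒢₃ (he : IsLabelling f t P w₁ w₂ w₃ e) (hs₂ : s₂ = 1) (hs₃ : s₃ = 0)
    (hs₁ : 2 ≤ s₁) (hmin : A₂min s₁ s₂ s₃ ≤ G.comap e)
    (h₀ : ∀ v, v ≠ w₁ → v ≠ w₂ → v ≠ w₃ → t v = 0 → ∀ z, G.Adj v z → z = f v ∨ z = w₁) :
    Mem𝒢₃ G := by
  subst hs₂ hs₃
  refine ⟨s₁, hs₁, G.comap e, hmin, ?_, ⟨(Iso.comap e G).symm⟩⟩
  have hb : base s₁ 1 0 ≤ A₃max s₁ := base_le_A₂min.trans le_sup_left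
  have hc : ∀ a b, a ∈ ({u₁, u₂, u₃} ∪ L₂ s₁ 1 0 : Set (Vertex s₁ 1 0)) →
      b ∈ ({u₁, u₂, u₃} ∪ L₂ s₁ 1 0 : Set (Vertex s₁ 1 0)) → a ≠ b → (A₃max s₁).Adj a b := by
    intro a b ha hb hab
    refine (le_sup_right : completeOn _ ≤ A₃max s₁) ?_
    rw [completeOn, fromRel_adj]
    exact ⟨hab, Or.inl ⟨ha, hb⟩⟩
  have hx : ∀ j b z, (G.comap e).Adj (x₁ j b) z → z = x₁ j !b ∨ z = u₁ := by
    intro j b z h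
    obtain ⟨n1, n2, n3⟩ := he.apply_ne (x₁ j b) (by simp) (by simp) (by simp)
    have := h₀ _ n1 n2 n3 (he.t₁ _ _) _ h
    rwa [he.f₁, ← he.e₁, e.injective.eq_iff, e.injective.eq_iff] at this
  have hz : ∀ a z, a ∈ L₂ s₁ 1 0 → (G.comap e).Adj a z →
      z ∈ ({u₁, u₂, u₃} ∪ L₂ s₁ 1 0 : Set (Vertex s₁ 1 0)) := by
    intro a z ha h
    cases z with
    | x₁ j b =>
      obtain ⟨i, rfl | rfl⟩ := ha <;> rcases hx _ _ _ h.symm with h' | h' <;> cases h'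
    | x₃ j b => exact j.elim0
    | v₁ j => exact Or.inr ⟨j, Or.inl rfl⟩
    | v₃ j => exact Or.inr ⟨j, Or.inr rfl⟩
    | _ => simp
  refine le_of_cases (fun _ => hb base_u₁_u₂) (fun _ => hc _ _ (by simp) (by simp) (by simp))
    (fun _ => hb base_u₂_u₃) ?_ ?_ ?_ (fun j => j.elim0)
  · intro j b z h
    rcases hx j b z h with rfl | rfl
    · exact hb (base_x₁ j b)
    · cases b <;> simp [A₃max, A₃min, A₂min, joinTo, L₁]
  · intro j z h
    have ha : v₁ j ∈ L₂ s₁ 1 0 := ⟨j, Or.inl rfl⟩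
    exact hc _ _ (Or.inr ha) (hz _ _ ha h) h.ne
  · intro j z h
    have ha : v₃ j ∈ L₂ s₁ 1 0 := ⟨j, Or.inr rfl⟩
    exact hc _ _ (Or.inr ha) (hz _ _ ha h) h.ne

theorem IsLabelling.mem𝒢₄ (he : IsLabelling f t P w₁ w₂ w₃ e) (hs₂ : s₂ = 2) (hs₃ : s₃ = 0)
    (hs₁ : 1 ≤ s₁) (hmin : A₂min s₁ s₂ s₃ ≤ G.comap e)
    (h₀ : ∀ v, v ≠ w₁ → v ≠ w₂ → v ≠ w₃ → t v = 0 → ∀ z, G.Adj v z → z = f v ∨ z = w₁)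
    (h₁ : ∀ v, P v → ∀ z, G.Adj v z → z = f v ∨ z = w₁)
    (h₁' : ∀ v, P v → ∀ z, G.Adj (f v) z → z ≠ w₂)
    (hf : ∀ v v', P v → P v' → v ≠ v' → G.Adj (f v) (f v')) :
    Mem𝒢₄ G := by
  subst hs₂ hs₃
  have hb : base s₁ 2 0 ≤ A₄max s₁ := base_le_A₂min.trans
    (le_sup_of_le_left (le_sup_of_le_left (le_sup_of_le_left le_sup_left)))
  refine ⟨s₁, hs₁, G.comap e, sup_le hmin (edge_le ?_), ?_, ⟨(Iso.comap e G).symm⟩⟩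
  · have := hf _ _ (he.prop 0) (he.prop 1) (by simp)
    simpa [he.f₂] using this
  have hx : ∀ j b z, (G.comap e).Adj (x₁ j b) z → z = x₁ j !b ∨ z = u₁ := by
    intro j b z h
    obtain ⟨n1, n2, n3⟩ := he.apply_ne (x₁ j b) (by simp) (by simp) (by simp)
    have := h₀ _ n1 n2 n3 (he.t₁ _ _) _ h
    rwa [he.f₁, ← he.e₁, e.injective.eq_iff, e.injective.eq_iff] at this
  have hv₁ : ∀ j z, (G.comap e).Adj (v₁ j) z → z = v₃ j ∨ z = u₁ := by
    intro j z h
    have := h₁ _ (he.prop j) _ h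
    rwa [he.f₂, ← he.e₁, e.injective.eq_iff, e.injective.eq_iff] at this
  refine le_of_cases (fun _ => hb base_u₁_u₂) (fun _ => by simp [A₄max, edge_adj])
    (fun _ => hb base_u₂_u₃) ?_ ?_ ?_ (fun j => j.elim0)
  · intro j b z h
    rcases hx j b z h with rfl | rfl
    · exact hb (base_x₁ j b)
    · cases b <;> simp [A₄max, A₄min, A₂min, joinTo, L₁]
  · intro j z h
    rcases hv₁ j z h with rfl | rfl
    · exact hb (base_v₁_v₃ j)
    · fin_cases j <;> simp [A₄max, A₄min, A₂min, joinTo]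
  · intro j z h
    cases z with
    | u₁ => fin_cases j <;> simp [A₄max, edge_adj]
    | u₂ =>
      exfalso
      refine h₁' _ (he.prop j) (e u₂) ?_ he.e₂
      rw [he.f₂]
      exact h
    | u₃ => fin_cases j <;> simp [A₄max, A₄min, A₂min, joinTo]
    | x₁ i b => rcases hx _ _ _ h.symm with h' | h' <;> cases h'
    | v₁ i =>
      rcases hv₁ _ _ h.symm with h' | h'
      · cases h'; exact hb (base_v₁_v₃ _).symm
      · cases h'
    | v₃ i =>
      have := h.ne
      revert this
      fin_cases j <;> fin_cases i <;> simp [A₄max, A₄min, edge_adj]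
    | x₃ i b => exact i.elim0

end Families

/-! ### No nice pentagon: nice triangles and 𝒢₁. -/

section Triangles

open HypoFamilies

variable {V : Type*} {G : SimpleGraph V} {f : V → V}

theorem IsMatch.remove {S : Set V} (h : IsMatch G f S) {c : V} (hc : c ∈ S) :
    IsMatch G f {v | v ∈ S ∧ v ≠ c ∧ v ≠ f c} := by
  intro v ⟨h1, h2, h3⟩
  obtain ⟨k1, k2, k3⟩ := h v h1
  refine ⟨⟨k1, fun e => h3 (by rw [← e, k3]), fun e => h2 ?_⟩, k2, k3⟩
  rw [← k3, e, (h c hc).2.2]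

theorem IsMatch.exists_insert {S : Set V} (h : IsMatch G f S) {a b : V} (hab : G.Adj a b)
    (ha : a ∉ S) (hb : b ∉ S) :
    ∃ f', IsMatch G f' {v | v ∈ S ∨ v = a ∨ v = b} ∧ (∀ v ∈ S, f' v = f v) ∧ f' a = b ∧
      f' b = a := by
  classical
  let f' : V → V := fun v => if v = a then b else if v = b then a else f v
  have hS : ∀ v ∈ S, f' v = f v := fun v hv => by
    have h1 : v ≠ a := fun e => ha (e ▸ hv)
    have h2 : v ≠ b := fun e => hb (e ▸ hv)
    simp [f', h1, h2]
  have h1 : f' a = b := by simp [f']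
  have h2 : f' b = a := by simp [f', hab.ne.symm]
  refine ⟨f', ?_, hS, h1, h2⟩
  rintro v (hv | rfl | rfl)
  · rw [hS v hv, hS _ (h v hv).1]
    exact ⟨Or.inl (h v hv).1, (h v hv).2⟩
  · rw [h1, h2]; exact ⟨by simp, hab, rfl⟩
  · rw [h2, h1]; exact ⟨by simp, hab.symm, rfl⟩

theorem NoNicePath.false_of_path (hP : NoNicePath G) {S : Set V} (hf : IsMatch G f S)
    (a₀ a₁ a₂ a₃ a₄ a₅ a₆ a₇ a₈ : V) (hnd : [a₀, a₁, a₂, a₃, a₄, a₅, a₆, a₇, a₈].Nodup)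
    (h₀ : G.Adj a₀ a₁) (h₁ : G.Adj a₁ a₂) (h₂ : G.Adj a₂ a₃) (h₃ : G.Adj a₃ a₄)
    (h₄ : G.Adj a₄ a₅) (h₅ : G.Adj a₅ a₆) (h₆ : G.Adj a₆ a₇) (h₇ : G.Adj a₇ a₈)
    (hS : ∀ v, v ∈ S ↔ v ∉ [a₀, a₁, a₂, a₃, a₄, a₅, a₆, a₇, a₈]) : False := by
  refine hP [a₀, a₁, a₂, a₃, a₄, a₅, a₆, a₇, a₈] rfl hnd ?_ f ?_
  · simp only [List.isChain_cons_cons, List.isChain_singleton, and_true]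
    exact ⟨h₀, h₁, h₂, h₃, h₄, h₅, h₆, h₇⟩
  · rwa [show {v | v ∉ [a₀, a₁, a₂, a₃, a₄, a₅, a₆, a₇, a₈]} = S from
      Set.ext fun v => (hS v).symm]

theorem niceCycle_five {S : Set V} (hf : IsMatch G f S)
    (a₀ a₁ a₂ a₃ a₄ : V) (hnd : [a₀, a₁, a₂, a₃, a₄].Nodup)
    (h₀ : G.Adj a₀ a₁) (h₁ : G.Adj a₁ a₂) (h₂ : G.Adj a₂ a₃) (h₃ : G.Adj a₃ a₄)
    (h₄ : G.Adj a₄ a₀)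
    (hS : ∀ v, v ∈ S ↔ v ∉ [a₀, a₁, a₂, a₃, a₄]) :
    NiceCycle G (n := 5) ![a₀, a₁, a₂, a₃, a₄] f where
  inj := by
    have : List.ofFn ![a₀, a₁, a₂, a₃, a₄] = [a₀, a₁, a₂, a₃, a₄] := by simp [List.ofFn_succ]
    rw [← this] at hnd
    exact List.nodup_ofFn.1 hnd
  adj := by
    have h5 : ∀ q : ZMod 5 → Prop, q 0 → q 1 → q 2 → q 3 → q 4 → ∀ i, q i := by
      intro q a b c d e i; fin_cases i <;> assumption
    exact h5 _ h₀ h₁ h₂ h₃ h₄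
  isMatch := by
    have : (Set.range ![a₀, a₁, a₂, a₃, a₄])ᶜ = S := by
      ext v
      rw [hS]
      simp [eq_comm]
      tauto
    exact this ▸ hf

theorem niceCycle_seven {S : Set V} (hf : IsMatch G f S)
    (a₀ a₁ a₂ a₃ a₄ a₅ a₆ : V) (hnd : [a₀, a₁, a₂, a₃, a₄, a₅, a₆].Nodup)
    (h₀ : G.Adj a₀ a₁) (h₁ : G.Adj a₁ a₂) (h₂ : G.Adj a₂ a₃) (h₃ : G.Adj a₃ a₄)
    (h₄ : G.Adj a₄ a₅) (h₅ : G.Adj a₅ a₆) (h₆ : G.Adj a₆ a₀)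
    (hS : ∀ v, v ∈ S ↔ v ∉ [a₀, a₁, a₂, a₃, a₄, a₅, a₆]) :
    NiceCycle G (n := 7) ![a₀, a₁, a₂, a₃, a₄, a₅, a₆] f where
  inj := by
    have : List.ofFn ![a₀, a₁, a₂, a₃, a₄, a₅, a₆] = [a₀, a₁, a₂, a₃, a₄, a₅, a₆] := by
      simp [List.ofFn_succ]
    rw [← this] at hnd
    exact List.nodup_ofFn.1 hnd
  adj := by
    have h7 : ∀ q : ZMod 7 → Prop, q 0 → q 1 → q 2 → q 3 → q 4 → q 5 → q 6 → ∀ i, q i := by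
      intro q a b c d e g h i; fin_cases i <;> assumption
    exact h7 _ h₀ h₁ h₂ h₃ h₄ h₅ h₆
  isMatch := by
    have : (Set.range ![a₀, a₁, a₂, a₃, a₄, a₅, a₆])ᶜ = S := by
      ext v
      rw [hS]
      simp [eq_comm]
      tauto
    exact this ▸ hf

/-- A triangle of `G` whose complement is perfectly matched by `f`. -/
structure NiceTriangle (G : SimpleGraph V) (u : Fin 3 → V) (f : V → V) : Prop where
  adj : ∀ i j, i ≠ j → G.Adj (u i) (u j)
  isMatch : IsMatch G f (Set.range u)ᶜ

theorem NiceTriangle.mk' {S : Set V} (hf : IsMatch G f S) {a b c : V} (hab : G.Adj a b)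
    (hac : G.Adj a c) (hbc : G.Adj b c) (hS : ∀ v, v ∈ S ↔ v ≠ a ∧ v ≠ b ∧ v ≠ c) :
    NiceTriangle G ![a, b, c] f where
  adj i j h := by
    fin_cases i <;> fin_cases j <;> simp at h ⊢ <;> first | assumption | (symm; assumption)
  isMatch := by
    have : (Set.range ![a, b, c])ᶜ = S := by
      ext v
      rw [hS]
      simp [eq_comm]
      tauto
    exact this ▸ hf

variable {u : Fin 3 → V}

theorem NiceTriangle.mem_range {i j k : Fin 3} (hij : i ≠ j) (hik : i ≠ k) (hjk : j ≠ k) (v : V) :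
    v ∈ Set.range u ↔ v = u i ∨ v = u j ∨ v = u k := by
  constructor
  · rintro ⟨l, rfl⟩
    have : l = i ∨ l = j ∨ l = k := by omega
    rcases this with rfl | rfl | rfl <;> simp
  · rintro (rfl | rfl | rfl) <;> exact Set.mem_range_self _

theorem exists_third (i : Fin 3) : ∃ j k : Fin 3, i ≠ j ∧ i ≠ k ∧ j ≠ k := by
  revert i; decide

theorem exists_third' {i j : Fin 3} (h : i ≠ j) : ∃ k : Fin 3, i ≠ k ∧ j ≠ k := by
  revert i j; decide

/-- A hypomatchable graph of order at least `9` without a nice path of order `9`. -/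
structure HypoNoNicePath [Fintype V] (G : SimpleGraph V) : Prop where
  noNicePath : NoNicePath G
  hypomatchable : Hypomatchable G
  card : 9 ≤ Fintype.card V

/-- No cycle of order `5` has a complement with a perfect matching. -/
def NoNicePentagon (G : SimpleGraph V) : Prop :=
  ∀ (p : ZMod 5 → V) f, ¬ NiceCycle G p f

variable [Fintype V]

/-- Matching the other two corners with each other leaves only `u i` unmatched, so `blossom` applies
at `u i`. -/
theorem NiceTriangle.adj_mate (hT : NiceTriangle G u f) (hG : HypoNoNicePath G)
    (h5 : NoNicePentagon G) {c : V} (hc : c ∉ Set.range u)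
    {i : Fin 3} (hci : G.Adj (u i) c) : G.Adj (u i) (f c) := by
  obtain ⟨j, k, hij, hik, hjk⟩ := exists_third i
  have hr := NiceTriangle.mem_range (u := u) hij hik hjk
  obtain ⟨f', h1, h2, -, -⟩ := hT.isMatch.exists_insert (hT.adj j k hjk) (by simp) (by simp)
  have hS : {v | v ∈ (Set.range u)ᶜ ∨ v = u j ∨ v = u k} = {u i}ᶜ := by
    ext v
    have := (hT.adj i j hij).ne
    have := (hT.adj i k hik).ne
    simp only [Set.mem_ofPred_eq, Set.mem_compl_iff, hr, Set.mem_singleton_iff]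
    grind
  rw [hS] at h1
  rcases blossom hG.noNicePath hG.hypomatchable hG.card h1 hci with h | ⟨p, hp⟩
  · rwa [h2 c hc] at h
  · exact absurd hp (h5 p f')

/-- Otherwise the edge from `c` to its mate and the third corner would complete a nice pentagon. -/
theorem NiceTriangle.eq_of_adj (hT : NiceTriangle G u f) (hG : HypoNoNicePath G)
    (h5 : NoNicePentagon G) {c : V} (hc : c ∉ Set.range u)
    {i j : Fin 3} (hi : G.Adj (u i) c) (hj : G.Adj (u j) c) : i = j := by
  by_contra hij
  obtain ⟨k, hik, hjk⟩ := exists_third' hij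
  have hr := NiceTriangle.mem_range (u := u) hij hik hjk
  have h1 := hT.isMatch c hc
  have hm := hT.isMatch.remove (c := c) hc
  have hj' := hT.adj_mate hG h5 hc hj
  have e1 := hT.adj i j hij
  have e2 := hT.adj i k hik
  have e3 := hT.adj j k hjk
  have d1 := h1.1
  simp only [Set.mem_compl_iff, hr] at d1 hc
  refine h5 _ f (niceCycle_five hm (u i) c (f c) (u j) (u k) ?_ hi h1.2.1 hj'.symm e3 e2.symm ?_)
  · have := e1.ne; have := e2.ne; have := e3.ne; have := h1.2.1.ne
    simp; grind
  · intro v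
    simp only [Set.mem_ofPred_eq, Set.mem_compl_iff, hr]
    simp; grind

/-- Far away vertices cannot hang on a triangle with further pendant edges. -/
theorem NiceTriangle.no_long_chain (hT : NiceTriangle G u f) (hG : HypoNoNicePath G)
    (h5 : NoNicePentagon G) {i j : Fin 3} (hij : i ≠ j) {w h q : V} (hw : w ∉ Set.range u)
    (hq : q ∉ Set.range u) (hh : h ∉ Set.range u) (hwi : G.Adj (u i) w) (hqj : G.Adj (u j) q)
    (hwh : G.Adj w h) (hn : ∀ l, ¬ G.Adj (u l) h) : False := by
  obtain ⟨k, hik, hjk⟩ := exists_third' hij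
  have hr := NiceTriangle.mem_range (u := u) hij hik hjk
  have hw1 := hT.isMatch w hw
  have hq1 := hT.isMatch q hq
  have hh1 := hT.isMatch h hh
  have hwi' := hT.adj_mate hG h5 hw hwi
  have hqj' := hT.adj_mate hG h5 hq hqj
  have n1 : q ≠ w := fun e => hij (hT.eq_of_adj hG h5 hw hwi (e ▸ hqj))
  have n2 : q ≠ f w := fun e => hij (hT.eq_of_adj hG h5 hw1.1 hwi' (e ▸ hqj))
  have n3 : h ≠ w := hwh.ne.symm
  have n4 : h ≠ f w := fun e => hn i (e ▸ hwi')
  have n5 : h ≠ q := fun e => hn j (e ▸ hqj)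
  have n6 : h ≠ f q := fun e => hn j (e ▸ hqj')
  have e1 := hT.adj i j hij
  have e2 := hT.adj i k hik
  have e3 := hT.adj j k hjk
  have hm := hT.isMatch.remove hw
  have hm2 := hm.remove (c := q) ⟨hq, n1, n2⟩
  have k1 : f h ≠ w := fun e => n4 (by rw [← e, hh1.2.2])
  have k2 : f h ≠ f w := fun e => n3 (by rw [← hh1.2.2, e, hw1.2.2])
  have k3 : f h ≠ q := fun e => n6 (by rw [← e, hh1.2.2])
  have k4 : f h ≠ f q := fun e => n5 (by rw [← hh1.2.2, e, hq1.2.2])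
  have k5 : f q ≠ w := fun e => n2 (by rw [← e, hq1.2.2])
  have k6 : f q ≠ f w := fun e => n1 (by rw [← hq1.2.2, e, hw1.2.2])
  have hm3 := hm2.remove (c := h) ⟨⟨hh, n3, n4⟩, n5, n6⟩
  have d1 := hw1.1
  have d2 := hq1.1
  have d3 := hh1.1
  simp only [Set.mem_compl_iff, hr, not_or] at d1 d2 d3 hw hq hh
  -- Three matched pairs and the triangle account for the nine vertices; the triangle is crossed
  -- through its third corner.
  refine hG.noNicePath.false_of_path hm3 (f h) h w (f w) (u i) (u k) (u j) q (f q) ?_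
    hh1.2.1.symm hwh.symm hw1.2.1 hwi'.symm e2 e3.symm hqj hq1.2.1 ?_
  · have := e1.ne; have := e2.ne; have := e3.ne; have := hw1.2.1.ne; have := hq1.2.1.ne
    have := hh1.2.1.ne
    simp; grind
  · intro v
    simp only [Set.mem_ofPred_eq, Set.mem_compl_iff, hr]
    simp; grind

/-- A nice triangle is full if every vertex outside is adjacent to it. -/
def IsFull (G : SimpleGraph V) (u : Fin 3 → V) : Prop :=
  ∀ v ∉ Set.range u, ∃ i, G.Adj (u i) v

theorem exists_pendant_of_not_isFull (hG : HypoNoNicePath G) (hu : ¬ IsFull G u) :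
    ∃ i, ∃ w ∉ Set.range u, G.Adj (u i) w ∧ ∃ h ∉ Set.range u, G.Adj w h ∧
      ∀ l, ¬ G.Adj (u l) h := by
  simp only [IsFull, not_forall, not_exists] at hu
  obtain ⟨b, hb, hbn⟩ := hu
  obtain ⟨w, hw, h, hh, hwh⟩ := hG.hypomatchable.preconnected.exists_crossing
    (S := {v | v ∈ Set.range u ∨ ∃ i, G.Adj (u i) v}) (a := u 0) (b := b) (by simp)
    (by simpa using ⟨by simpa using hb, hbn⟩)
  simp only [Set.mem_ofPred_eq, not_or, not_exists] at hh
  by_cases hwu : w ∈ Set.range u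
  · obtain ⟨i, rfl⟩ := hwu
    exact absurd hwh (hh.2 i)
  · obtain ⟨i, hi⟩ := hw.resolve_left hwu
    exact ⟨i, w, hwu, hi, h, hh.1, hwh, hh.2⟩

/-- A vertex out of reach would yield a long chain at some corner, and one of the two given pendants
hangs on a different corner. -/
theorem NiceTriangle.isFull_of_pendants (hT : NiceTriangle G u f) (hG : HypoNoNicePath G)
    (h5 : NoNicePentagon G) {i j : Fin 3} (hij : i ≠ j) {p q : V} (hp : p ∉ Set.range u)
    (hq : q ∉ Set.range u) (hpi : G.Adj (u i) p) (hqj : G.Adj (u j) q) : IsFull G u := by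
  by_contra hu
  obtain ⟨l, w, hw, hwl, h, hh, hwh, hn⟩ := exists_pendant_of_not_isFull hG hu
  by_cases hl : l = j
  · subst hl
    exact hT.no_long_chain hG h5 hij.symm hw hp hh hwl hpi hwh hn
  · exact hT.no_long_chain hG h5 hl hw hq hh hwl hqj hwh hn

/-- If a nice triangle is not full, the argument moves to the triangle formed by one of its corners
and a pair hanging there, chosen so that two corners of the new triangle carry pendants. -/
theorem NoNicePentagon.exists_isFull (hG : HypoNoNicePath G) (h5 : NoNicePentagon G) :
    ∃ u f, NiceTriangle G u f ∧ IsFull G u := by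
  have hne : Nontrivial V := Fintype.one_lt_card_iff_nontrivial.1 (by have := hG.card; omega)
  obtain ⟨x, y, hxy⟩ := hne.exists_pair_ne
  obtain ⟨f, hf⟩ := hG.hypomatchable.exists_isMatch x
  obtain ⟨a, -, hxa⟩ := hG.hypomatchable.exists_adj_ne hxy
  have ha := hf a hxa.ne.symm
  have hxa' : G.Adj x (f a) := by
    rcases blossom hG.noNicePath hG.hypomatchable hG.card hf hxa with h | ⟨p, hp⟩
    · exact h
    · exact absurd hp (h5 p f)
  have hm := hf.remove (c := a) hxa.ne.symm
  have hT := NiceTriangle.mk' hm hxa hxa' ha.2.1 (by intro v; simp)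
  generalize ![x, a, f a] = u at hT
  by_cases hu : IsFull G u
  · exact ⟨u, f, hT, hu⟩
  obtain ⟨i, d, hd, hid, e, he, hde, hn⟩ := exists_pendant_of_not_isFull hG hu
  obtain ⟨j, k, hij, hik, hjk⟩ := exists_third i
  have hr := NiceTriangle.mem_range (u := u) hij hik hjk
  have hid' := hT.adj_mate hG h5 hd hid
  have hd1 := hT.isMatch d hd
  have he1 := hT.isMatch e he
  have e1 := hT.adj i j hij
  have e2 := hT.adj i k hik
  have e3 := hT.adj j k hjk
  have hed : e ≠ f d := fun h => hn i (h ▸ hid')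
  have hm2 := hT.isMatch.remove hd
  obtain ⟨f', h1, h2, h3, h4⟩ := hm2.exists_insert e3 (by simp) (by simp)
  have d1 := hd1.1
  have d2 := he1.1
  simp only [Set.mem_compl_iff, hr, not_or] at d1 d2 hd he
  -- Now `u j` hangs on `u i`, and `e` hangs on `d`.
  have hT' : NiceTriangle G ![u i, d, f d] f' := by
    refine NiceTriangle.mk' h1 hid hid' hd1.2.1 ?_
    intro v
    simp only [Set.mem_ofPred_eq, Set.mem_compl_iff, hr]
    have := e1.ne; have := e2.ne
    grind
  refine ⟨_, f', hT', hT'.isFull_of_pendants hG h5 (i := 0) (j := 1) (by simp) (p := u j) (q := e)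
    ?_ ?_ e1 hde⟩
  · have := e1.ne
    simp; grind
  · have := hde.ne
    simp; grind

theorem NiceTriangle.eq_mate_of_adj (hT : NiceTriangle G u f) (hG : HypoNoNicePath G)
    (h5 : NoNicePentagon G) (hu : IsFull G u) {v z : V} (hv : v ∉ Set.range u)
    (hz : z ∉ Set.range u) (hvz : G.Adj v z) : z = f v := by
  by_contra hne
  obtain ⟨i, hi⟩ := hu v hv
  obtain ⟨j, hj⟩ := hu z hz
  have hv1 := hT.isMatch v hv
  have hz1 := hT.isMatch z hz
  have hi' := hT.adj_mate hG h5 hv hi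
  have hj' := hT.adj_mate hG h5 hz hj
  have hm := hT.isMatch.remove hv
  have hm2 := hm.remove (c := z) ⟨hz, hvz.ne.symm, hne⟩
  have k1 : f z ≠ v := fun e => hne (by rw [← e, hz1.2.2])
  have k2 : f z ≠ f v := fun e => hvz.ne (by rw [← hv1.2.2, ← e, hz1.2.2])
  have d1 := hv1.1
  have d2 := hz1.1
  have := hvz.ne; have := hv1.2.1.ne; have := hz1.2.1.ne
  -- An extra edge between two pairs closes a nice pentagon if they hang on the same corner, and a
  -- nice 7-cycle if they hang on different corners.
  by_cases hij : i = j
  · subst hij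
    obtain ⟨j, k, hij, hik, hjk⟩ := exists_third i
    have hr := NiceTriangle.mem_range (u := u) hij hik hjk
    have e1 := hT.adj i j hij
    have e2 := hT.adj i k hik
    have e3 := hT.adj j k hjk
    obtain ⟨f', h1, h2, h3, h4⟩ := hm2.exists_insert e3 (by simp) (by simp)
    simp only [Set.mem_compl_iff, hr, not_or] at d1 d2 hv hz
    have := e1.ne; have := e2.ne; have := e3.ne
    refine h5 _ f' (niceCycle_five h1 (u i) (f v) v z (f z) ?_ hi' hv1.2.1.symm hvz hz1.2.1
      hj'.symm ?_)
    · simp; grind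
    · intro v
      simp only [Set.mem_ofPred_eq, Set.mem_compl_iff, hr]
      simp; grind
  · obtain ⟨k, hik, hjk⟩ := exists_third' hij
    have hr := NiceTriangle.mem_range (u := u) hij hik hjk
    have e1 := hT.adj i j hij
    have e2 := hT.adj i k hik
    have e3 := hT.adj j k hjk
    simp only [Set.mem_compl_iff, hr, not_or] at d1 d2 hv hz
    have := e1.ne; have := e2.ne; have := e3.ne
    refine hG.noNicePath.not_niceCycle_seven hG.hypomatchable hG.card _ f
      (niceCycle_seven hm2 (u i) (f v) v z (f z) (u j) (u k) ?_ hi' hv1.2.1.symm hvz hz1.2.1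
      hj'.symm e3 e2.symm ?_)
    · simp; grind
    · intro v
      simp only [Set.mem_ofPred_eq, Set.mem_compl_iff, hr]
      simp; grind

theorem NoNicePentagon.mem𝒢₁ (hG : HypoNoNicePath G) (h5 : NoNicePentagon G) : Mem𝒢₁ G := by
  classical
  obtain ⟨u, f, hT, hu⟩ := h5.exists_isFull hG
  have hr := NiceTriangle.mem_range (u := u) (i := 0) (j := 1) (k := 2) (by simp) (by simp)
    (by simp)
  have e1 := hT.adj 0 1 (by simp)
  have e2 := hT.adj 0 2 (by simp)
  have e3 := hT.adj 1 2 (by simp)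
  have hrc : (Set.range u)ᶜ = ({u 0, u 1, u 2}ᶜ : Set V) := by
    ext v; simp only [Set.mem_compl_iff, hr]; simp
  have hm := hT.isMatch
  -- The label is the corner seen by `v`, with 0 as a dummy where there is none. Both ends of a pair
  -- play the same role here, so the orientation predicate below is trivial.
  let t : V → Fin 3 := fun v => if h : ∃ i, G.Adj (u i) v then h.choose else 0
  have ht : ∀ v ∉ Set.range u, G.Adj (u (t v)) v := by
    intro v hv
    have h := hu v hv
    simp only [t, dif_pos h]
    exact h.choose_spec
  obtain ⟨s₁, s₂, s₃, e, he, hcard⟩ := exists_isLabelling e1.ne e2.ne e3.ne (hrc ▸ hm) t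
    (fun v hv => by
      rw [← hrc] at hv
      exact hT.eq_of_adj hG h5 (hm v hv).1 (ht _ (hm v hv).1)
        (hT.adj_mate hG h5 hv (ht v hv)))
    (fun _ => True) (fun _ _ _ => Or.inl trivial)
  refine mem𝒢₁_of_isLabelling he (by have := hG.card; omega) e1 e2 e3 ?_
  intro v h0 h1 h2 z
  have hv : v ∉ Set.range u := by rw [hr]; tauto
  have hut : ∀ i, ![u 0, u 1, u 2] i = u i := by intro i; fin_cases i <;> rfl
  rw [hut]
  constructor
  · intro h
    by_cases hz : z ∈ Set.range u
    · obtain ⟨i, rfl⟩ := hz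
      exact Or.inr (congrArg u (hT.eq_of_adj hG h5 hv h.symm (ht v hv)))
    · exact Or.inl (hT.eq_mate_of_adj hG h5 hu hv hz h)
  · rintro (rfl | rfl)
    · exact (hm v hv).2.1
    · exact (ht v hv).symm

end Triangles

/-! ### How outside vertices attach to a nice pentagon. -/

section Pentagon

open HypoFamilies

variable {V : Type*} {G : SimpleGraph V} {f : V → V} {p : ZMod 5 → V}

theorem mem_range_pentagon (v : V) :
    v ∈ Set.range p ↔ v = p 0 ∨ v = p 1 ∨ v = p 2 ∨ v = p 3 ∨ v = p 4 := by
  constructor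
  · rintro ⟨i, rfl⟩
    have h : ∀ i : ZMod 5, i = 0 ∨ i = 1 ∨ i = 2 ∨ i = 3 ∨ i = 4 := by decide
    rcases h i with rfl | rfl | rfl | rfl | rfl <;> simp
  · rintro (rfl | rfl | rfl | rfl | rfl) <;> exact Set.mem_range_self _

theorem NiceCycle.nodup_pentagon (hp : NiceCycle G p f) : [p 0, p 1, p 2, p 3, p 4].Nodup := by
  have : ([0, 1, 2, 3, 4] : List (ZMod 5)).Nodup := by decide
  exact this.map hp.inj

theorem NiceCycle.adj_pentagon (hp : NiceCycle G p f) : G.Adj (p 0) (p 1) ∧ G.Adj (p 1) (p 2) ∧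
    G.Adj (p 2) (p 3) ∧ G.Adj (p 3) (p 4) ∧ G.Adj (p 4) (p 0) :=
  ⟨hp.adj 0, hp.adj 1, hp.adj 2, hp.adj 3, hp.adj 4⟩

theorem NiceCycle.range_rotate (k : ZMod 5) : Set.range (fun i => p (i + k)) = Set.range p :=
  (Equiv.addRight k).surjective.range_comp p

/-- Two distinct pairs of a matching are disjoint. -/
theorem IsMatch.pairs {S : Set V} (hf : IsMatch G f S) {c e : V} (hc : c ∈ S) (he : e ∈ S)
    (h1 : e ≠ c) (h2 : e ≠ f c) : f e ≠ c ∧ f e ≠ f c := by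
  have := hf c hc; have := hf e he
  grind

variable [Fintype V]

/-- Two matched pairs chained in front of the five pentagon vertices would form a nice path. -/
theorem NiceCycle.not_adj_mate_zero (hp : NiceCycle G p f) (hG : HypoNoNicePath G) {c e : V}
    (hc : c ∉ Set.range p) (he : e ∉ Set.range p) (h1 : e ≠ c) (h2 : e ≠ f c)
    (hc0 : G.Adj (p 0) c) : ¬ G.Adj (f c) e := by
  intro hce
  have hm := (hp.isMatch.remove hc).remove (c := e) ⟨he, h1, h2⟩
  have hc1 := hp.isMatch c hc
  have he1 := hp.isMatch e he
  obtain ⟨h3, h4⟩ := hp.isMatch.pairs hc he h1 h2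
  obtain ⟨a0, a1, a2, a3, a4⟩ := hp.adj_pentagon
  have hnd := hp.nodup_pentagon
  have := hc1.2.1.ne; have := he1.2.1.ne
  have d1 := hc1.1
  have d2 := he1.1
  simp only [Set.mem_compl_iff, mem_range_pentagon, not_or] at d1 d2 hc he
  refine hG.noNicePath.false_of_path hm (f e) e (f c) c (p 0) (p 1) (p 2) (p 3) (p 4) ?_
    he1.2.1.symm hce.symm hc1.2.1.symm hc0.symm a0 a1 a2 a3 ?_
  · simp at hnd ⊢; grind
  · intro v
    simp only [Set.mem_ofPred_eq, Set.mem_compl_iff, mem_range_pentagon]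
    simp; grind

theorem NiceCycle.not_adj_mate (hp : NiceCycle G p f) (hG : HypoNoNicePath G) {c e : V}
    (hc : c ∉ Set.range p) (he : e ∉ Set.range p) (h1 : e ≠ c) (h2 : e ≠ f c)
    {i : ZMod 5} (hci : G.Adj (p i) c) : ¬ G.Adj (f c) e := by
  rw [← NiceCycle.range_rotate i] at hc he
  exact (hp.rotate i).not_adj_mate_zero hG hc he h1 h2 (by simpa using hci)

/-- The mate has a second neighbour, which by `NiceCycle.not_adj_mate` cannot lie outside the
pentagon. -/
theorem NiceCycle.exists_adj_mate (hp : NiceCycle G p f) (hG : HypoNoNicePath G) {c : V}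
    (hc : c ∉ Set.range p) {i : ZMod 5} (hci : G.Adj (p i) c) : ∃ j, G.Adj (p j) (f c) := by
  have hc1 := hp.isMatch c hc
  obtain ⟨e, hec, hfe⟩ := hG.hypomatchable.exists_adj_ne hc1.2.1.ne.symm
  by_cases he : e ∈ Set.range p
  · obtain ⟨j, rfl⟩ := he
    exact ⟨j, hfe.symm⟩
  · exact absurd hfe (hp.not_adj_mate hG hc he hec hfe.ne.symm hci)

/-- By connectedness an unattached vertex `h` would be adjacent to an attached `w`; the mate of `w`
is attached as well, so `NiceCycle.not_adj_mate` forbids the edge `wh`. -/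
theorem NiceCycle.exists_adj (hp : NiceCycle G p f) (hG : HypoNoNicePath G) {v : V}
    (hv : v ∉ Set.range p) : ∃ i, G.Adj (p i) v := by
  by_contra hn
  obtain ⟨w, hw, h, hh, hwh⟩ := hG.hypomatchable.preconnected.exists_crossing
    (S := {v | v ∈ Set.range p ∨ ∃ i, G.Adj (p i) v}) (a := p 0) (b := v)
    (Or.inl (Set.mem_range_self _)) (by rintro (h | h) <;> contradiction)
  simp only [Set.mem_ofPred_eq, not_or, not_exists] at hh
  by_cases hwu : w ∈ Set.range p
  · obtain ⟨i, rfl⟩ := hwu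
    exact hh.2 i hwh
  · obtain ⟨i, hi⟩ := hw.resolve_left hwu
    obtain ⟨j, hj⟩ := hp.exists_adj_mate hG hwu hi
    have hw1 := hp.isMatch w hwu
    have h2 : h ≠ f w := fun e => hh.2 j (e ▸ hj)
    refine hp.not_adj_mate hG hw1.1 hh.1 h2 ?_ hj ?_
    · rw [hw1.2.2]; exact hwh.ne.symm
    · rwa [hw1.2.2]

theorem NiceCycle.eq_mate_of_adj (hp : NiceCycle G p f) (hG : HypoNoNicePath G) {v z : V}
    (hv : v ∉ Set.range p) (hz : z ∉ Set.range p) (hvz : G.Adj v z) : z = f v := by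
  by_contra hne
  have hv1 := hp.isMatch v hv
  obtain ⟨i, hi⟩ := hp.exists_adj hG hv1.1
  refine hp.not_adj_mate hG hv1.1 hz hne ?_ hi ?_
  · rw [hv1.2.2]; exact hvz.ne.symm
  · rwa [hv1.2.2]

/-- The pair could be inserted into the pentagon edge, giving a nice 7-cycle. -/
theorem NiceCycle.not_consecutive_mate_zero (hp : NiceCycle G p f) (hG : HypoNoNicePath G) {c : V}
    (hc : c ∉ Set.range p) (h0 : G.Adj (p 0) c) : ¬ G.Adj (p 1) (f c) := by
  intro h1
  have hm := hp.isMatch.remove hc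
  have hc1 := hp.isMatch c hc
  obtain ⟨a0, a1, a2, a3, a4⟩ := hp.adj_pentagon
  have hnd := hp.nodup_pentagon
  have := hc1.2.1.ne
  have d1 := hc1.1
  simp only [Set.mem_compl_iff, mem_range_pentagon, not_or] at d1 hc
  refine hG.noNicePath.not_niceCycle_seven hG.hypomatchable hG.card _ f
      (niceCycle_seven hm c (f c) (p 1) (p 2) (p 3) (p 4) (p 0) ?_ hc1.2.1 h1.symm a1 a2 a3 a4
      h0 ?_)
  · simp at hnd ⊢; grind
  · intro v
    simp only [Set.mem_ofPred_eq, Set.mem_compl_iff, mem_range_pentagon]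
    simp; grind

theorem NiceCycle.not_consecutive_mate (hp : NiceCycle G p f) (hG : HypoNoNicePath G) {c : V}
    (hc : c ∉ Set.range p) {i : ZMod 5} (h0 : G.Adj (p i) c) : ¬ G.Adj (p (i + 1)) (f c) := by
  rw [← NiceCycle.range_rotate i] at hc
  have := (hp.rotate i).not_consecutive_mate_zero hG hc (by simpa using h0)
  rwa [add_comm] at this

theorem NiceCycle.not_consecutive_mate' (hp : NiceCycle G p f) (hG : HypoNoNicePath G) {c : V}
    (hc : c ∉ Set.range p) {i : ZMod 5} (h0 : G.Adj (p (i + 1)) c) : ¬ G.Adj (p i) (f c) := by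
  intro h1
  have hc1 := hp.isMatch c hc
  refine hp.not_consecutive_mate hG hc1.1 h1 ?_
  rwa [hc1.2.2]

/-- Cutting the pentagon at that edge and adding a pair at either end gives a nice path. -/
theorem NiceCycle.not_consecutive_zero (hp : NiceCycle G p f) (hG : HypoNoNicePath G) {c e : V}
    (hc : c ∉ Set.range p) (he : e ∉ Set.range p) (h1 : e ≠ c) (h2 : e ≠ f c)
    (h0 : G.Adj (p 0) c) : ¬ G.Adj (p 1) e := by
  intro hce
  have hm := (hp.isMatch.remove hc).remove (c := e) ⟨he, h1, h2⟩
  have hc1 := hp.isMatch c hc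
  have he1 := hp.isMatch e he
  obtain ⟨h3, h4⟩ := hp.isMatch.pairs hc he h1 h2
  obtain ⟨a0, a1, a2, a3, a4⟩ := hp.adj_pentagon
  have hnd := hp.nodup_pentagon
  have := hc1.2.1.ne; have := he1.2.1.ne
  have d1 := hc1.1
  have d2 := he1.1
  simp only [Set.mem_compl_iff, mem_range_pentagon, not_or] at d1 d2 hc he
  refine hG.noNicePath.false_of_path hm (f e) e (p 1) (p 2) (p 3) (p 4) (p 0) c (f c) ?_
    he1.2.1.symm hce.symm a1 a2 a3 a4 h0 hc1.2.1 ?_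
  · simp at hnd ⊢; grind
  · intro v
    simp only [Set.mem_ofPred_eq, Set.mem_compl_iff, mem_range_pentagon]
    simp; grind

theorem NiceCycle.not_consecutive (hp : NiceCycle G p f) (hG : HypoNoNicePath G) {c e : V}
    (hc : c ∉ Set.range p) (he : e ∉ Set.range p) (h1 : e ≠ c) (h2 : e ≠ f c)
    {i : ZMod 5} (h0 : G.Adj (p i) c) : ¬ G.Adj (p (i + 1)) e := by
  rw [← NiceCycle.range_rotate i] at hc he
  have := (hp.rotate i).not_consecutive_zero hG hc he h1 h2 (by simpa using h0)
  rwa [add_comm] at this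

theorem NiceCycle.not_consecutive' (hp : NiceCycle G p f) (hG : HypoNoNicePath G) {c e : V}
    (hc : c ∉ Set.range p) (he : e ∉ Set.range p) (h1 : e ≠ c) (h2 : e ≠ f c)
    {i : ZMod 5} (h0 : G.Adj (p (i + 1)) c) : ¬ G.Adj (p i) e := by
  intro h
  refine hp.not_consecutive hG he hc h1.symm ?_ h h0
  have := (hp.isMatch c hc); have := hp.isMatch e he
  grind

end Pentagon

/-! ### A single attachment vertex, and the exceptional configuration of 𝒢₄. -/

section Pentagon

open HypoFamilies

variable {V : Type*} {G : SimpleGraph V} {f : V → V} {p : ZMod 5 → V}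

/-- Adding the edge `p 3`, `p 4` of a nice pentagon to the matching. -/
theorem NiceCycle.exists_extend (hp : NiceCycle G p f) :
    ∃ f', IsMatch G f' ({p 0, p 1, p 2}ᶜ : Set V) ∧ (∀ v ∉ Set.range p, f' v = f v) ∧
      f' (p 3) = p 4 ∧ f' (p 4) = p 3 ∧
      ∀ v, v ≠ p 0 → v ≠ p 1 → v ≠ p 2 → v ∉ Set.range p ∨ v = p 3 ∨ v = p 4 := by
  obtain ⟨f', h1, h2, h3, h4⟩ := hp.isMatch.exists_insert hp.adj_pentagon.2.2.2.1 (by simp)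
    (by simp)
  have hnd := hp.nodup_pentagon
  have hS : {v | v ∈ (Set.range p)ᶜ ∨ v = p 3 ∨ v = p 4} = ({p 0, p 1, p 2}ᶜ : Set V) := by
    ext v
    simp only [Set.mem_ofPred_eq, Set.mem_compl_iff, mem_range_pentagon]
    simp at hnd ⊢; grind
  refine ⟨f', hS ▸ h1, h2, h3, h4, ?_⟩
  intro v g0 g1 g2
  rw [mem_range_pentagon]
  tauto

variable [Fintype V]

/-- The path `p 0`, `p 1`, `p 2` plays the role of `Q`, and `p 4`, `p 3` form the single pair
`L_{2,1}`. -/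
theorem NiceCycle.mem𝒢₃ (hp : NiceCycle G p f) (hG : HypoNoNicePath G)
    (h : ∀ v ∉ Set.range p, ∀ i, G.Adj (p i) v → i = 0) : Mem𝒢₃ G := by
  classical
  obtain ⟨f', hm, hf', h34, h43, hout⟩ := hp.exists_extend
  obtain ⟨a0, a1, a2, a3, a4⟩ := hp.adj_pentagon
  have hinj : ∀ i j, p i = p j ↔ i = j := fun i j => hp.inj.eq_iff
  have hrange : ∀ i, p i ∈ Set.range p := Set.mem_range_self
  let t : V → Fin 3 := fun v => if v = p 3 ∨ v = p 4 then 1 else 0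
  have ht3 : t (p 3) = 1 := by simp [t]
  have ht4 : t (p 4) = 1 := by simp [t]
  have hto : ∀ v ∉ Set.range p, t v = 0 := by
    intro v hv
    have h1 : v ≠ p 3 := fun e => hv (e ▸ hrange 3)
    have h2 : v ≠ p 4 := fun e => hv (e ▸ hrange 4)
    simp [t, h1, h2]
  have hcompl : ∀ v ∈ ({p 0, p 1, p 2}ᶜ : Set V), v ∉ Set.range p ∨ v = p 3 ∨ v = p 4 := by
    intro v hv
    simp only [Set.mem_compl_iff, Set.mem_insert_iff, Set.mem_singleton_iff, not_or] at hv
    exact hout v hv.1 hv.2.1 hv.2.2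
  obtain ⟨s₁, s₂, s₃, e, he, hcard⟩ := exists_isLabelling a0.ne
    (by rw [Ne, hinj]; decide) a1.ne hm t
    (by
      intro v hv
      rcases hcompl v hv with hv | rfl | rfl
      · rw [hto v hv, hf' v hv, hto _ (hp.isMatch v hv).1]
      · rw [h34, ht3, ht4]
      · rw [h43, ht3, ht4]) (fun v => v = p 4)
    (by
      intro v hv h1
      rcases hcompl v hv with hv | rfl | rfl
      · simp [hto v hv] at h1
      · exact Or.inr h34
      · exact Or.inl rfl)
  have ht0 : ∀ v, v ≠ p 0 → v ≠ p 1 → v ≠ p 2 → t v = 0 → v ∉ Set.range p := by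
    intro v h0 h1 h2 h3
    rcases hout v h0 h1 h2 with hv | rfl | rfl
    · exact hv
    · simp [ht3] at h3
    · simp [ht4] at h3
  have ht2 : ∀ v, t v ≠ 2 := by
    intro v
    simp only [t]
    split_ifs <;> simp
  have hs₃ := he.s₃_eq_zero fun v _ _ _ => ht2 v
  have hs₂ : s₂ = 1 := by
    rw [he.s₂_eq_card {p 4} (by simp)]
    · simp
    · intro v hv
      rw [Finset.mem_singleton] at hv
      subst hv
      rw [h43, ht4]
      simp only [Ne, hinj]
      decide
  have hs₁ : 2 ≤ s₁ := by have := hG.card; omega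
  refine he.mem𝒢₃ hs₂ hs₃ hs₁ (he.A₂min_le hm a0 a1 ?_ (fun v _ _ _ h2 => absurd h2 (ht2 v)) ?_) ?_
  · intro v h0 h1 h2 h3
    obtain ⟨i, hi⟩ := hp.exists_adj hG (ht0 v h0 h1 h2 h3)
    rwa [h v (ht0 v h0 h1 h2 h3) i hi] at hi
  · rintro v rfl
    rw [h43]
    exact ⟨a4.symm, a2⟩
  · intro v h0 h1 h2 h3 z hz
    have hv := ht0 v h0 h1 h2 h3
    by_cases hzr : z ∈ Set.range p
    · obtain ⟨i, rfl⟩ := hzr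
      rw [h v hv i hz.symm]
      simp
    · left
      rw [hf' v hv]
      exact hp.eq_mate_of_adj hG hv hzr hz

/-- Each chord would give a path from `p 0` to `p 2` or `p 3` through all five pentagon vertices,
which the pair closes to a nice 7-cycle. -/
theorem NiceCycle.chords_of_opposite (hp : NiceCycle G p f) (hG : HypoNoNicePath G) {c : V}
    (hc : c ∉ Set.range p) (h2 : G.Adj (p 2) c) (h3 : G.Adj (p 3) c) (h0 : G.Adj (p 0) (f c)) :
    ¬ G.Adj (p 1) (p 3) ∧ ¬ G.Adj (p 1) (p 4) ∧ ¬ G.Adj (p 2) (p 4) := by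
  have hm := hp.isMatch.remove hc
  have hc1 := hp.isMatch c hc
  obtain ⟨a0, a1, a2, a3, a4⟩ := hp.adj_pentagon
  have hnd := hp.nodup_pentagon
  have := hc1.2.1.ne
  have d1 := hc1.1
  simp only [Set.mem_compl_iff, mem_range_pentagon, not_or] at d1 hc
  have h7 := hG.noNicePath.not_niceCycle_seven hG.hypomatchable hG.card
  refine ⟨fun h => ?_, fun h => ?_, fun h => ?_⟩
  · refine h7 _ f (niceCycle_seven hm (f c) c (p 2) (p 1) (p 3) (p 4) (p 0) ?_ hc1.2.1.symm
      h2.symm a1.symm h a3 a4 h0 ?_)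
    · simp at hnd ⊢; grind
    · intro v
      simp only [Set.mem_ofPred_eq, Set.mem_compl_iff, mem_range_pentagon]
      simp; grind
  · refine h7 _ f (niceCycle_seven hm (f c) c (p 2) (p 3) (p 4) (p 1) (p 0) ?_ hc1.2.1.symm
      h2.symm a2 a3 h.symm a0.symm h0 ?_)
    · simp at hnd ⊢; grind
    · intro v
      simp only [Set.mem_ofPred_eq, Set.mem_compl_iff, mem_range_pentagon]
      simp; grind
  · refine h7 _ f (niceCycle_seven hm (f c) c (p 3) (p 4) (p 2) (p 1) (p 0) ?_ hc1.2.1.symm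
      h3.symm a3 h.symm a1.symm a0.symm h0 ?_)
    · simp at hnd ⊢; grind
    · intro v
      simp only [Set.mem_ofPred_eq, Set.mem_compl_iff, mem_range_pentagon]
      simp; grind

theorem NiceCycle.mem𝒢₄ (hp : NiceCycle G p f) (hG : HypoNoNicePath G) {c : V}
    (hc : c ∉ Set.range p) (h2 : G.Adj (p 2) c) (h3 : G.Adj (p 3) c) (h0 : G.Adj (p 0) (f c)) :
    Mem𝒢₄ G := by
  classical
  obtain ⟨f', hm, hf', h34, h43, hout⟩ := hp.exists_extend
  obtain ⟨a0, a1, a2, a3, a4⟩ := hp.adj_pentagon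
  obtain ⟨c13, c14, c24⟩ := hp.chords_of_opposite hG hc h2 h3 h0
  have hc1 := hp.isMatch c hc
  have hinj : ∀ i j, p i = p j ↔ i = j := fun i j => hp.inj.eq_iff
  have hrange : ∀ i, p i ∈ Set.range p := Set.mem_range_self
  have hcp : ∀ i, c ≠ p i := fun i e => hc (e ▸ hrange i)
  have hdp : ∀ i, f c ≠ p i := fun i e => hc1.1 (e ▸ hrange i)
  have h5 : ∀ i : ZMod 5, i = 0 ∨ i = 1 ∨ i = 2 ∨ i = 3 ∨ i = 4 := by decide
  -- Each pentagon vertex other than `p 0` is consecutive to `p 2` or `p 3`, where `c` is attached.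
  have hother : ∀ v ∉ Set.range p, v ≠ c → v ≠ f c → ∀ i, G.Adj (p i) v → i = 0 := by
    intro v hv n1 n2 i hi
    have n3 : v ≠ f (f c) := by rwa [hc1.2.2]
    rcases h5 i with rfl | rfl | rfl | rfl | rfl
    · rfl
    · exact absurd hi (hp.not_consecutive' hG hc hv n1 n2 (i := 1) h2)
    · exact absurd hi (hp.not_consecutive' hG hc hv n1 n2 (i := 2) h3)
    · exact absurd hi (hp.not_consecutive hG hc hv n1 n2 (i := 2) h2)
    · exact absurd hi (hp.not_consecutive hG hc hv n1 n2 (i := 3) h3)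
  have hd : ∀ i, G.Adj (p i) (f c) → i = 0 := by
    intro i hi
    rcases h5 i with rfl | rfl | rfl | rfl | rfl
    · rfl
    · exact absurd hi (hp.not_consecutive_mate' hG hc (i := 1) h2)
    · exact absurd hi (hp.not_consecutive_mate' hG hc (i := 2) h3)
    · exact absurd hi (hp.not_consecutive_mate hG hc (i := 2) h2)
    · exact absurd hi (hp.not_consecutive_mate hG hc (i := 3) h3)
  have hc41 : ¬ G.Adj (p 4) c := fun h => hp.not_consecutive_mate hG hc (i := 4) h h0
  have hc11 : ¬ G.Adj (p 1) c := fun h => hp.not_consecutive_mate' hG hc (i := 0) h h0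
  let t : V → Fin 3 := fun v => if v = p 3 ∨ v = p 4 ∨ v = c ∨ v = f c then 1 else 0
  have ht3 : t (p 3) = 1 := by simp [t]
  have ht4 : t (p 4) = 1 := by simp [t]
  have htc : t c = 1 := by simp [t]
  have htd : t (f c) = 1 := by simp [t]
  have hto : ∀ v ∉ Set.range p, v ≠ c → v ≠ f c → t v = 0 := by
    intro v hv n1 n2
    have h1 : v ≠ p 3 := fun e => hv (e ▸ hrange 3)
    have h2 : v ≠ p 4 := fun e => hv (e ▸ hrange 4)
    simp [t, h1, h2, n1, n2]
  have hcompl : ∀ v, v ≠ p 0 → v ≠ p 1 → v ≠ p 2 →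
      (v ∉ Set.range p ∧ v ≠ c ∧ v ≠ f c) ∨ v = p 3 ∨ v = p 4 ∨ v = c ∨ v = f c := by
    intro v n0 n1 n2
    have := hout v n0 n1 n2
    tauto
  have hcompl' : ∀ v ∈ ({p 0, p 1, p 2}ᶜ : Set V),
      (v ∉ Set.range p ∧ v ≠ c ∧ v ≠ f c) ∨ v = p 3 ∨ v = p 4 ∨ v = c ∨ v = f c := by
    intro v hv
    simp only [Set.mem_compl_iff, Set.mem_insert_iff, Set.mem_singleton_iff, not_or] at hv
    exact hcompl v hv.1 hv.2.1 hv.2.2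
  have hfc : f' c = f c := hf' c hc
  have hfd : f' (f c) = c := by rw [hf' _ hc1.1, hc1.2.2]
  -- The two pairs labelled 1 are oriented with `p 4` and `f c` as the `v₁` ends; the adjacent
  -- vertices `p 3` and `c` become the `v₃` ends.
  obtain ⟨s₁, s₂, s₃, e, he, hcard⟩ := exists_isLabelling a0.ne
    (by rw [Ne, hinj]; decide) a1.ne hm t
    (by
      intro v hv
      rcases hcompl' v hv with ⟨hv, n1, n2⟩ | rfl | rfl | rfl | rfl
      · obtain ⟨n3, n4⟩ := hp.isMatch.pairs hc hv n1 n2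
        rw [hto v hv n1 n2, hf' v hv, hto _ (hp.isMatch v hv).1 n3 n4]
      · rw [h34, ht3, ht4]
      · rw [h43, ht3, ht4]
      · rw [hfc, htc, htd]
      · rw [hfd, htc, htd]) (fun v => v = p 4 ∨ v = f c)
    (by
      intro v hv h1
      rcases hcompl' v hv with ⟨hv, n1, n2⟩ | rfl | rfl | rfl | rfl
      · simp [hto v hv n1 n2] at h1
      · exact Or.inr (Or.inl h34)
      · exact Or.inl (Or.inl rfl)
      · exact Or.inr (Or.inr hfc)
      · exact Or.inl (Or.inr rfl))
  have ht0 : ∀ v, v ≠ p 0 → v ≠ p 1 → v ≠ p 2 → t v = 0 →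
      v ∉ Set.range p ∧ v ≠ c ∧ v ≠ f c := by
    intro v h0 h1 h2 h3
    rcases hcompl v h0 h1 h2 with hv | rfl | rfl | rfl | rfl
    · exact hv
    · simp [ht3] at h3
    · simp [ht4] at h3
    · simp [htc] at h3
    · simp [htd] at h3
  have ht2 : ∀ v, t v ≠ 2 := by
    intro v
    simp only [t]
    split_ifs <;> simp
  have hs₃ := he.s₃_eq_zero fun v _ _ _ => ht2 v
  have hs₂ : s₂ = 2 := by
    rw [he.s₂_eq_card {p 4, f c} (by simp)]
    · exact Finset.card_pair (hdp 4).symm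
    · intro v hv
      rw [Finset.mem_insert, Finset.mem_singleton] at hv
      rcases hv with rfl | rfl
      · rw [h43, ht4]
        simp only [Ne, hinj, (hdp _).symm, or_false]
        decide
      · rw [hfd, htd]
        exact ⟨hdp 0, hdp 1, hdp 2, rfl, by simp [hcp, hc1.2.1.ne]⟩
  have hs₁ : 1 ≤ s₁ := by have := hG.card; omega
  refine he.mem𝒢₄ hs₂ hs₃ hs₁ (he.A₂min_le hm a0 a1 ?_ (fun v _ _ _ h2 => absurd h2 (ht2 v)) ?_)
    ?_ ?_ ?_ ?_
  · intro v n0 n1 n2 n3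
    obtain ⟨hv, n4, n5⟩ := ht0 v n0 n1 n2 n3
    obtain ⟨i, hi⟩ := hp.exists_adj hG hv
    rwa [hother v hv n4 n5 i hi] at hi
  · rintro v (rfl | rfl)
    · rw [h43]
      exact ⟨a4.symm, a2⟩
    · rw [hfd]
      exact ⟨h0, h2⟩
  · intro v n0 n1 n2 n3 z hz
    obtain ⟨hv, n4, n5⟩ := ht0 v n0 n1 n2 n3
    by_cases hzr : z ∈ Set.range p
    · obtain ⟨i, rfl⟩ := hzr
      rw [hother v hv n4 n5 i hz.symm]
      simp
    · left
      rw [hf' v hv]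
      exact hp.eq_mate_of_adj hG hv hzr hz
  · rintro v (rfl | rfl) z hz
    · rw [h43]
      by_cases hzr : z ∈ Set.range p
      · rw [mem_range_pentagon] at hzr
        rcases hzr with rfl | rfl | rfl | rfl | rfl
        · simp
        · exact absurd hz.symm c14
        · exact absurd hz.symm c24
        · simp
        · exact absurd rfl hz.ne
      · exfalso
        by_cases n1 : z = c
        · exact hc41 (n1 ▸ hz)
        · by_cases n2 : z = f c
          · exact absurd (hd 4 (n2 ▸ hz)) (by decide)
          · exact absurd (hother z hzr n1 n2 4 hz) (by decide)
    · by_cases hzr : z ∈ Set.range p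
      · obtain ⟨i, rfl⟩ := hzr
        rw [hd i hz.symm]
        simp
      · left
        rw [hf' _ hc1.1]
        exact hp.eq_mate_of_adj hG hc1.1 hzr hz
  · rintro v (rfl | rfl) z hz rfl
    · rw [h43] at hz
      exact c13 hz.symm
    · rw [hfd] at hz
      exact hc11 hz.symm
  · rintro v v' (rfl | rfl) (rfl | rfl) hne
    · exact absurd rfl hne
    · rw [h43, hfd]; exact h3
    · rw [h43, hfd]; exact h3.symm
    · exact absurd rfl hne

end Pentagon

/-! ### Two attachment vertices at distance two, and the pentagon case assembled. -/

section Pentagon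

open HypoFamilies Vertex

variable {V : Type*} [Fintype V] {G : SimpleGraph V} {f : V → V} {p : ZMod 5 → V}

theorem NiceCycle.chords_of_parallel (hp : NiceCycle G p f) (hG : HypoNoNicePath G) {c : V}
    (hc : c ∉ Set.range p) (h0 : G.Adj (p 0) c) (h2 : G.Adj (p 2) (f c)) :
    ¬ G.Adj (p 1) (p 3) ∧ ¬ G.Adj (p 1) (p 4) := by
  have hm := hp.isMatch.remove hc
  have hc1 := hp.isMatch c hc
  obtain ⟨a0, a1, a2, a3, a4⟩ := hp.adj_pentagon
  have hnd := hp.nodup_pentagon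
  have := hc1.2.1.ne
  have d1 := hc1.1
  simp only [Set.mem_compl_iff, mem_range_pentagon, not_or] at d1 hc
  have h7 := hG.noNicePath.not_niceCycle_seven hG.hypomatchable hG.card
  refine ⟨fun h => ?_, fun h => ?_⟩
  · refine h7 _ f (niceCycle_seven hm c (f c) (p 2) (p 1) (p 3) (p 4) (p 0) ?_ hc1.2.1
      h2.symm a1.symm h a3 a4 h0 ?_)
    · simp at hnd ⊢; grind
    · intro v
      simp only [Set.mem_ofPred_eq, Set.mem_compl_iff, mem_range_pentagon]
      simp; grind
  · refine h7 _ f (niceCycle_seven hm c (f c) (p 2) (p 3) (p 4) (p 1) (p 0) ?_ hc1.2.1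
      h2.symm a2 a3 h.symm a0.symm h0 ?_)
    · simp at hnd ⊢; grind
    · intro v
      simp only [Set.mem_ofPred_eq, Set.mem_compl_iff, mem_range_pentagon]
      simp; grind

/-- Either chord would give a path from `p 0` to `p 2` through all pentagon vertices, to be extended
by one pair at each end. -/
theorem NiceCycle.chords_of_two_pairs (hp : NiceCycle G p f) (hG : HypoNoNicePath G) {c e : V}
    (hc : c ∉ Set.range p) (he : e ∉ Set.range p) (h1 : e ≠ c) (h2 : e ≠ f c)
    (hc0 : G.Adj (p 0) c) (he2 : G.Adj (p 2) e) :
    ¬ G.Adj (p 1) (p 3) ∧ ¬ G.Adj (p 1) (p 4) := by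
  have hm := (hp.isMatch.remove hc).remove (c := e) ⟨he, h1, h2⟩
  have hc1 := hp.isMatch c hc
  have he1 := hp.isMatch e he
  obtain ⟨h3, h4⟩ := hp.isMatch.pairs hc he h1 h2
  obtain ⟨a0, a1, a2, a3, a4⟩ := hp.adj_pentagon
  have hnd := hp.nodup_pentagon
  have := hc1.2.1.ne; have := he1.2.1.ne
  have d1 := hc1.1
  have d2 := he1.1
  simp only [Set.mem_compl_iff, mem_range_pentagon, not_or] at d1 d2 hc he
  refine ⟨fun h => ?_, fun h => ?_⟩
  · refine hG.noNicePath.false_of_path hm (f c) c (p 0) (p 4) (p 3) (p 1) (p 2) e (f e) ?_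
      hc1.2.1.symm hc0.symm a4.symm a3.symm h.symm a1 he2 he1.2.1 ?_
    · simp at hnd ⊢; grind
    · intro v
      simp only [Set.mem_ofPred_eq, Set.mem_compl_iff, mem_range_pentagon]
      simp; grind
  · refine hG.noNicePath.false_of_path hm (f c) c (p 0) (p 1) (p 4) (p 3) (p 2) e (f e) ?_
      hc1.2.1.symm hc0.symm a0 h a3.symm a2.symm he2 he1.2.1 ?_
    · simp at hnd ⊢; grind
    · intro v
      simp only [Set.mem_ofPred_eq, Set.mem_compl_iff, mem_range_pentagon]
      simp; grind

/-- With no chord from `p 1` to `p 3` or `p 4`, the pair `p 4`, `p 3` is just one more pair between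
`p 0` and `p 2`. -/
theorem NiceCycle.mem𝒢₂ (hp : NiceCycle G p f) (hG : HypoNoNicePath G)
    (h : ∀ v ∉ Set.range p, ∀ i, G.Adj (p i) v → i = 0 ∨ i = 2) {x y : V}
    (hx : x ∉ Set.range p) (hx0 : G.Adj (p 0) x) (hy : y ∉ Set.range p) (hy2 : G.Adj (p 2) y) :
    Mem𝒢₂ G := by
  classical
  obtain ⟨f', hm, hf', h34, h43, hout⟩ := hp.exists_extend
  obtain ⟨a0, a1, a2, a3, a4⟩ := hp.adj_pentagon
  have hinj : ∀ i j, p i = p j ↔ i = j := fun i j => hp.inj.eq_iff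
  have hrange : ∀ i, p i ∈ Set.range p := Set.mem_range_self
  have hf := hp.isMatch
  have hor : ∀ v ∉ Set.range p, G.Adj (p 0) v ∨ G.Adj (p 2) v := by
    intro v hv
    obtain ⟨i, hi⟩ := hp.exists_adj hG hv
    rcases h v hv i hi with rfl | rfl
    · exact Or.inl hi
    · exact Or.inr hi
  obtain ⟨c13, c14⟩ : ¬ G.Adj (p 1) (p 3) ∧ ¬ G.Adj (p 1) (p 4) := by
    by_cases n1 : y = x
    · subst n1
      rcases hor _ (hf y hy).1 with h' | h'
      · exact hp.chords_of_parallel hG (hf y hy).1 h' ((hf y hy).2.2.symm ▸ hy2)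
      · exact hp.chords_of_parallel hG hy hx0 h'
    · by_cases n2 : y = f x
      · exact hp.chords_of_parallel hG hx hx0 (n2 ▸ hy2)
      · exact hp.chords_of_two_pairs hG hx hy n1 n2 hx0 hy2
  -- `U i` is a property of the whole pair. A pair is labelled by which of `p 0` and `p 2` it sees:
  -- only `p 0`, both, or only `p 2`.
  let U : ZMod 5 → V → Prop := fun i v => G.Adj (p i) v ∨ G.Adj (p i) (f v)
  have hU : ∀ i, ∀ v ∉ Set.range p, U i (f v) ↔ U i v := by
    intro i v hv
    simp only [U, (hf v hv).2.2]
    exact or_comm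
  let t : V → Fin 3 := fun v =>
    if v = p 3 ∨ v = p 4 then 1 else if U 0 v then (if U 2 v then 1 else 0) else 2
  have ht3 : t (p 3) = 1 := by simp [t]
  have ht4 : t (p 4) = 1 := by simp [t]
  have hto : ∀ v ∉ Set.range p, t v = if U 0 v then (if U 2 v then 1 else 0) else 2 := by
    intro v hv
    have h1 : v ≠ p 3 := fun e => hv (e ▸ hrange 3)
    have h2 : v ≠ p 4 := fun e => hv (e ▸ hrange 4)
    simp [t, h1, h2]
  have hto0 : ∀ v ∉ Set.range p, t v = 0 → ¬ U 2 v := by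
    intro v hv h0 hu
    rw [hto v hv] at h0
    simp only [hu, if_true] at h0
    split_ifs at h0 <;> simp at h0
  have hto2 : ∀ v ∉ Set.range p, t v = 2 → ¬ U 0 v := by
    intro v hv h0 hu
    rw [hto v hv] at h0
    simp only [hu, if_true] at h0
    split_ifs at h0 <;> simp at h0
  have hto1 : ∀ v ∉ Set.range p, t v = 1 → U 0 v ∧ U 2 v := by
    intro v hv h0
    rw [hto v hv] at h0
    by_cases g0 : U 0 v <;> by_cases g2 : U 2 v <;> simp [g0, g2] at h0 ⊢
  have htf : ∀ v ∉ Set.range p, t (f v) = t v := by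
    intro v hv
    rw [hto v hv, hto _ (hf v hv).1]
    simp only [hU 0 v hv, hU 2 v hv]
  clear_value t
  have hcompl : ∀ v ∈ ({p 0, p 1, p 2}ᶜ : Set V), v ∉ Set.range p ∨ v = p 3 ∨ v = p 4 := by
    intro v hv
    simp only [Set.mem_compl_iff, Set.mem_insert_iff, Set.mem_singleton_iff, not_or] at hv
    exact hout v hv.1 hv.2.1 hv.2.2
  have hP4 : G.Adj (p 0) (p 4) ∧ G.Adj (p 2) (f' (p 4)) := ⟨a4.symm, h43 ▸ a2⟩
  -- A pair seeing both `p 0` and `p 2` can be oriented as required, because each of its ends sees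
  -- at least one of them.
  obtain ⟨s₁, s₂, s₃, e, he, hcard⟩ := exists_isLabelling a0.ne
    (by rw [Ne, hinj]; decide) a1.ne hm t
    (by
      intro v hv
      rcases hcompl v hv with hv | rfl | rfl
      · rw [hf' v hv, htf v hv]
      · rw [h34, ht3, ht4]
      · rw [h43, ht3, ht4]) (fun v => G.Adj (p 0) v ∧ G.Adj (p 2) (f' v))
    (by
      intro v hv h1
      rcases hcompl v hv with hv | rfl | rfl
      · have h2 := hto1 v hv h1
        have h3 := hor v hv
        have h4 := hor _ (hf v hv).1
        rw [hf' v hv, hf' _ (hf v hv).1, (hf v hv).2.2]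
        simp only [U] at h2
        tauto
      · exact Or.inr (h34 ▸ hP4)
      · exact Or.inl hP4)
  have ht0 : ∀ v, v ≠ p 0 → v ≠ p 1 → v ≠ p 2 → t v ≠ 1 → v ∉ Set.range p := by
    intro v h0 h1 h2 h3
    rcases hout v h0 h1 h2 with hv | rfl | rfl
    · exact hv
    · exact absurd ht3 h3
    · exact absurd ht4 h3
  have hne : ∀ v ∉ Set.range p, v ≠ p 0 ∧ v ≠ p 1 ∧ v ≠ p 2 := by
    intro v hv
    rw [mem_range_pentagon] at hv
    tauto
  have hnbr : ∀ v ∉ Set.range p, ∀ z, G.Adj v z → z = f' v ∨ z = p 0 ∨ z = p 2 := by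
    intro v hv z hz
    by_cases hzr : z ∈ Set.range p
    · obtain ⟨i, rfl⟩ := hzr
      rcases h v hv i hz.symm with rfl | rfl <;> simp
    · left
      rw [hf' v hv]
      exact hp.eq_mate_of_adj hG hv hzr hz
  obtain ⟨j₀, hj₀⟩ := he.exists_v (v := p 4) (by rw [Ne, hinj]; decide) (by rw [Ne, hinj]; decide)
    (by rw [Ne, hinj]; decide) ht4
  have hs₂ : 1 ≤ s₂ := by have := j₀.isLt; omega
  -- An outside pair labelled 1 is a second one besides `p 3`, `p 4`. If there is none, `x` and `y`
  -- have labels 0 and 2.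
  have hs : (1 ≤ s₁ ∧ 1 ≤ s₃) ∨ 2 ≤ s₂ := by
    by_cases hex : ∃ c, c ∉ Set.range p ∧ t c = 1
    · right
      obtain ⟨c, hc, hc1⟩ := hex
      obtain ⟨n0, n1, n2⟩ := hne c hc
      obtain ⟨j, hj⟩ := he.exists_v n0 n1 n2 hc1
      by_contra hlt
      have hjj : j = j₀ := Fin.ext (by have := j.isLt; have := j₀.isLt; omega)
      subst hjj
      have e1 := he.f₂ j
      have e2 := he.f₂' j
      apply hc
      rcases hj with hj | hj <;> rcases hj₀ with hj₀ | hj₀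
      · rw [← hj, hj₀]; exact hrange 4
      · rw [← hj, ← e2, hj₀, h43]; exact hrange 3
      · rw [← hj, ← e1, hj₀, h43]; exact hrange 3
      · rw [← hj, hj₀]; exact hrange 4
    · left
      simp only [not_exists, not_and] at hex
      have hx1 := hex x hx
      have hy1 := hex y hy
      have hx2 : t x ≠ 2 := fun e => hto2 x hx e (Or.inl hx0)
      have hy0 : t y ≠ 0 := fun e => hto0 y hy e (Or.inl hy2)
      have htx : t x = 0 := by omega
      have hty : t y = 2 := by omega
      obtain ⟨n0, n1, n2⟩ := hne x hx
      obtain ⟨m0, m1, m2⟩ := hne y hy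
      obtain ⟨j, -, -⟩ := he.exists_x₁ n0 n1 n2 htx
      obtain ⟨j', -, -⟩ := he.exists_x₃ m0 m1 m2 hty
      have := j.isLt; have := j'.isLt
      omega
  refine he.mem𝒢₂ hs₂ (by have := hG.card; omega) hs (he.A₂min_le hm a0 a1 ?_ ?_ ?_) ?_ ?_ ?_
  · intro v n0 n1 n2 n3
    have hv := ht0 v n0 n1 n2 (by simp [n3])
    exact (hor v hv).resolve_right fun g => hto0 v hv n3 (Or.inl g)
  · intro v n0 n1 n2 n3
    have hv := ht0 v n0 n1 n2 (by simp [n3])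
    exact (hor v hv).resolve_left fun g => hto2 v hv n3 (Or.inl g)
  · exact fun v hv => hv
  · intro v n0 n1 n2 n3 z hz
    have hv := ht0 v n0 n1 n2 (by simp [n3])
    rcases hnbr v hv z hz with g | g | rfl
    · exact Or.inl g
    · exact Or.inr g
    · exact absurd (Or.inl hz.symm) (hto0 v hv n3)
  · intro v n0 n1 n2 n3 z hz
    rcases hout v n0 n1 n2 with hv | hv
    · exact hnbr v hv z hz
    · have hv' : f' v = p 3 ∧ v = p 4 ∨ f' v = p 4 ∧ v = p 3 := by
        rcases hv with rfl | rfl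
        · exact Or.inr ⟨h34, rfl⟩
        · exact Or.inl ⟨h43, rfl⟩
      by_cases hzr : z ∈ Set.range p
      · rw [mem_range_pentagon] at hzr
        rcases hzr with rfl | rfl | rfl | rfl | rfl
        · simp
        · exfalso
          rcases hv with rfl | rfl
          · exact c13 hz.symm
          · exact c14 hz.symm
        · simp
        · rcases hv' with ⟨g1, g2⟩ | ⟨g1, g2⟩
          · exact Or.inl g1.symm
          · exact absurd g2 hz.ne
        · rcases hv' with ⟨g1, g2⟩ | ⟨g1, g2⟩
          · exact absurd g2 hz.ne
          · exact Or.inl g1.symm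
      · exfalso
        rcases hv with rfl | rfl
        · exact absurd (h z hzr 3 hz) (by decide)
        · exact absurd (h z hzr 4 hz) (by decide)
  · intro v n0 n1 n2 n3 z hz
    have hv := ht0 v n0 n1 n2 (by simp [n3])
    rcases hnbr v hv z hz with g | rfl | g
    · exact Or.inl g
    · exact absurd (Or.inl hz.symm) (hto2 v hv n3)
    · exact Or.inr g

theorem NiceCycle.mem_families (hp : NiceCycle G p f) (hG : HypoNoNicePath G) :
    Mem𝒢₂ G ∨ Mem𝒢₃ G ∨ Mem𝒢₄ G := by
  have hrot : ∀ k, Set.range (fun i => p (i + k)) = Set.range p := NiceCycle.range_rotate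
  by_cases hY : ∃ c ∉ Set.range p, ∃ i, G.Adj (p (2 + i)) c ∧ G.Adj (p (3 + i)) c ∧
      G.Adj (p i) (f c)
  · obtain ⟨c, hc, i, h2, h3, h0⟩ := hY
    rw [← hrot i] at hc
    exact Or.inr (Or.inr ((hp.rotate i).mem𝒢₄ hG hc h2 h3 (by simpa using h0)))
  -- Once the 𝒢₄ configuration is excluded, no two consecutive pentagon vertices are attached. If
  -- one vertex saw both, its mate could only attach at the opposite pentagon vertex.
  have hcons : ∀ x ∉ Set.range p, ∀ y ∉ Set.range p, ∀ i, G.Adj (p i) x →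
      ¬ G.Adj (p (i + 1)) y := by
    intro x hx y hy i hxi hyi
    by_cases n1 : y = x
    · subst n1
      obtain ⟨j, hj⟩ := hp.exists_adj_mate hG hy hxi
      have n1 : j ≠ i + 1 := fun e => hp.not_consecutive_mate hG hy hxi (e ▸ hj)
      have n2 : j ≠ i := fun e => hp.not_consecutive_mate' hG hy hyi (e ▸ hj)
      have n3 : j ≠ i + 1 + 1 := fun e => hp.not_consecutive_mate hG hy hyi (e ▸ hj)
      have n4 : i ≠ j + 1 := fun e => hp.not_consecutive_mate' hG hy (e ▸ hxi) hj
      have key : ∀ i j : ZMod 5, j ≠ i + 1 → j ≠ i → j ≠ i + 1 + 1 → i ≠ j + 1 →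
          i = 2 + j ∧ i + 1 = 3 + j := by decide
      obtain ⟨e1, e2⟩ := key i j n1 n2 n3 n4
      exact hY ⟨y, hy, j, e1 ▸ hxi, e2 ▸ hyi, hj⟩
    · by_cases n2 : y = f x
      · exact hp.not_consecutive_mate hG hx hxi (n2 ▸ hyi)
      · exact hp.not_consecutive hG hx hy n1 n2 hxi hyi
  by_cases hone : ∃ k, ∀ v ∉ Set.range p, ∀ i, G.Adj (p i) v → i = k
  · obtain ⟨k, hk⟩ := hone
    refine Or.inr (Or.inl ((hp.rotate k).mem𝒢₃ hG ?_))
    intro v hv i hi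
    rw [hrot] at hv
    simpa using hk v hv _ hi
  · left
    simp only [not_exists, not_forall] at hone
    -- The index 0 is arbitrary and only supplies some attachment; the next instance supplies one at
    -- a different pentagon vertex.
    obtain ⟨x, hx, i, hi, -⟩ := hone 0
    obtain ⟨y, hy, j, hj, hij⟩ := hone i
    have n1 : j ≠ i + 1 := fun e => hcons x hx y hy i hi (e ▸ hj)
    have n2 : i ≠ j + 1 := fun e => hcons y hy x hx j hj (e ▸ hi)
    have key : ∀ i j : ZMod 5, j ≠ i → j ≠ i + 1 → i ≠ j + 1 → j = 2 + i ∨ i = 2 + j := by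
      decide
    -- Every other vertex of a 5-cycle is consecutive to `i` or `i + 2`, so there is no third
    -- attachment vertex.
    have key2 : ∀ i l : ZMod 5, i ≠ l + 1 → l ≠ i + 1 → 2 + i ≠ l + 1 → l ≠ 2 + i + 1 →
        l - i = 0 ∨ l - i = 2 := by decide
    have main : ∀ (x y : V) (i : ZMod 5), x ∉ Set.range p → y ∉ Set.range p → G.Adj (p i) x →
        G.Adj (p (2 + i)) y → Mem𝒢₂ G := by
      intro x y i hx hy hi hj
      refine (hp.rotate i).mem𝒢₂ hG ?_ (x := x) (y := y) (by rwa [hrot]) (by simpa using hi)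
        (by rwa [hrot]) hj
      intro v hv l hl
      rw [hrot] at hv
      have := key2 i (l + i) (fun e => hcons v hv x hx _ hl (e ▸ hi))
        (fun e => hcons x hx v hv _ hi (e ▸ hl)) (fun e => hcons v hv y hy _ hl (e ▸ hj))
        (fun e => hcons y hy v hv _ hj (e ▸ hl))
      simpa using this
    rcases key i j hij n1 n2 with e | e
    · exact main x y i hx hy hi (e ▸ hj)
    · exact main y x j hy hx hj (e ▸ hi)

end Pentagon

theorem proposition4p4 {V : Type*} [Fintype V] (G : SimpleGraph V)
    (hG : Hypomatchable G) (hcard : 9 ≤ Fintype.card V)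
    (hfactor : ¬ HasPathFactor {2, 9} G) :
    HypoFamilies.Mem𝒢₁ G ∨ HypoFamilies.Mem𝒢₂ G ∨
      HypoFamilies.Mem𝒢₃ G ∨ HypoFamilies.Mem𝒢₄ G := by
  have hC : HypoNoNicePath G := ⟨noNicePath_of_not_hasPathFactor hfactor, hG, hcard⟩
  by_cases h5 : NoNicePentagon G
  · exact Or.inl (h5.mem𝒢₁ hC)
  · simp only [NoNicePentagon, not_forall, not_not] at h5
    obtain ⟨p, f, hp⟩ := h5
    exact Or.inr (hp.mem_families hC)
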